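/- Let $M$ be a smooth manifold without boundary, finite dimensional or, more generally, modelled on a Banach space. Let $g$ be a smooth pseudo-Riemannian metric on $M$, i.e. a smooth symmetric bilinear form on $TM$ such that $T_xM\to T_x^*M$, $a\mapsto g_x(a,\cdot)$, is bijective for every $x$ (in finite dimension: $g_x$ is nondegenerate). Let $m:\mathbb R_{>0}\times M\to M$, $m_\lambda=m(\lambda,\cdot)$, be a smooth free action of the multiplicative group $\mathbb R_{>0}$, and let $P_x=\frac{d}{dt}\big|_{t=0}m(e^t,x)$ be the vector field it generates. Let $f:M\to\mathbb R_{>0}$ be smooth and $\alpha\in\mathbb R\setminus\{0\}$, and suppose that $(g,f)$ is a homogeneous pair of degree $\alpha$, that is, for all $\lambda>0$, $$m_\lambda^*g=\lambda^\alpha g,\qquad m_\lambda^*f=\lambda^\alpha f,\qquad g(P,\cdot)=df .$$ Suppose that $g$ is definite, i.e. positive definite or negative definite. For $l>0$ let $M_l=\{x\in M: f(x)=l\}$, which is a submanifold of $M$ since $df\neq 0$ everywhere, and let $g_l$ be the metric on $M_l$ induced by $g$. The sectional curvature of a metric $h$ is denoted by $K^h$. For real numbers $s,C_1,C_2$ with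 ($s>0$ and $C_1>0$), or ($s=0$ and $C_1\ge 0$), or ($s<0$ and $C_1\le 0$), put $$w(s,C_1,C_2,r)=\begin{cases} \dfrac{C_1}{s\,\cosh^2\!\big(\sqrt{C_1}(\log r+C_2)\big)} & s>0,\\[2ex] e^{C_2}\,r^{\pm 2\sqrt{C_1}} & s=0\ (\text{either choice of sign}),\\[1ex] \dfrac{C_1}{s\,\sin^2\!\big(\sqrt{-C_1}(\log r+C_2)\big)} & s<0,\ C_1<0,\\[2ex] \dfrac{-1}{s\,(\log r+C_2)^2} & s<0,\ C_1=0, \end{cases}$$ for all $r>0$ at which no denominator vanishes. (This is every $r>0$ when $s\ge0$, and the complement of a discrete subset of $\mathbb R_{>0}$ when $s<0$.) Let $C,C_1,C_2\in\mathbb R$ be such that $(s,C_1,C_2)$ with $s=C/\alpha$ satisfies the condition above, and set $$v(r)=\frac1r\,w\!\left(\frac C\alpha,C_1,C_2,r\right).$$ Consider the metric $(v\circ f)g$ on the open set $M'\subseteq M$ of all points $x$ such that $v$ is defined at $f(x)$ (so $M'=M$ if $\alpha C\ge0$), and fix any $l>0$. Then: - if $l\,K^{g_l}\ge \alpha C_1$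 for all tangent $2$-planes of $M_l$, then $K^{(v\circ f)g}\ge C$ for all tangent $2$-planes of $M'$; - if $l\,K^{g_l}\le \alpha C_1$ for all tangent $2$-planes of $M_l$, then $K^{(v\circ f)g}\le C$ for all tangent $2$-planes of $M'$; - if $l\,K^{g_l}= \alpha C_1$ for all tangent $2$-planes of $M_l$, then $K^{(v\circ f)g}= C$ for all tangent $2$-planes of $M'$. -/

import Mathlib

open Set
open scoped Manifold ContDiff

noncomputable section

namespace HomogPair

/-! ### Levi-Civita connection and curvature in linear coordinates -/

section Coordinates

variable {F : Type*} [NormedAddCommGroup F] [NormedSpace ℝ F]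

/-- The functional `w ↦ ½ (∂ᵤ G(v,w) + ∂ᵥ G(u,w) - ∂_w G(u,v))` at `p` (Koszul formula for constant
vector fields `u, v`), for a field `G` of bilinear forms on (an open subset of) `F`. -/
def koszul (G : F → F →L[ℝ] F →L[ℝ] ℝ) (p u v : F) : F →L[ℝ] ℝ :=
  (1 / 2 : ℝ) •
    (fderiv ℝ G p u v + fderiv ℝ G p v u - ((fderiv ℝ G p).flip u).flip v)

/-- The Christoffel map `Γ_p(u,v) = ∇ᵤ v` (`u, v` constant fields) of the Levi-Civita connection:
the vector with `G_p(Γ_p(u,v), w) = koszul G p u v w` for all `w`. -/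
def christoffel (G : F → F →L[ℝ] F →L[ℝ] ℝ) (p u v : F) : F :=
  (G p).inverse (koszul G p u v)

/-- The curvature tensor `R(u,v)w = ∇ᵤ∇ᵥw - ∇ᵥ∇ᵤw - ∇_{[u,v]}w` at `p`, expressed with constant
vector fields `u, v, w` (whose brackets vanish). -/
def coordCurvature (G : F → F →L[ℝ] F →L[ℝ] ℝ) (p u v w : F) : F :=
  fderiv ℝ (fun q => christoffel G q v w) p u - fderiv ℝ (fun q => christoffel G q u w) p v
    + christoffel G p u (christoffel G p v w) - christoffel G p v (christoffel G p u w)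

/-- The sectional curvature `G(R(u,v)v,u) / (G(u,u) G(v,v) - G(u,v)²)` at `p` of the plane spanned
by `u` and `v`. -/
def coordSectionalCurvature (G : F → F →L[ℝ] F →L[ℝ] ℝ) (p u v : F) : ℝ :=
  G p (coordCurvature G p u v v) u / (G p u u * G p v v - G p u v ^ 2)

end Coordinates

/-! ### Metrics on manifolds -/

section Manifold

variable {E : Type*} [NormedAddCommGroup E] [NormedSpace ℝ E]
  {M : Type*} [TopologicalSpace M] [ChartedSpace E M]
  {F : Type*} [NormedAddCommGroup F] [NormedSpace ℝ F]

/-- A field of continuous bilinear forms on the tangent spaces of `M`. -/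
abbrev BilinField (E : Type*) [NormedAddCommGroup E] [NormedSpace ℝ E]
    (M : Type*) [TopologicalSpace M] [ChartedSpace E M] : Type _ :=
  (x : M) → TangentSpace 𝓘(ℝ, E) x →L[ℝ] TangentSpace 𝓘(ℝ, E) x →L[ℝ] ℝ

/-- A smooth pseudo-Riemannian metric. When `E` is finite dimensional, `nondegenerate` says exactly
that no nonzero tangent vector is orthogonal to all tangent vectors. -/
structure PseudoRiemannianMetric (E : Type*) [NormedAddCommGroup E] [NormedSpace ℝ E]
    (M : Type*) [TopologicalSpace M] [ChartedSpace E M] [IsManifold 𝓘(ℝ, E) ∞ M] where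
  /-- the bilinear form on each tangent space -/
  val : BilinField E M
  symm : ∀ (x : M) (a b : TangentSpace 𝓘(ℝ, E) x), val x a b = val x b a
  nondegenerate : ∀ x : M, Function.Bijective (val x)
  contMDiff : ContMDiff 𝓘(ℝ, E) (𝓘(ℝ, E).prod 𝓘(ℝ, E →L[ℝ] E →L[ℝ] ℝ)) ∞
    (fun x => Bundle.TotalSpace.mk' (E →L[ℝ] E →L[ℝ] ℝ) x (val x))

/-- A metric is definite if it is positive definite or negative definite. -/
def PseudoRiemannianMetric.IsDefinite [IsManifold 𝓘(ℝ, E) ∞ M]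
    (g : PseudoRiemannianMetric E M) : Prop :=
  (∀ (x : M) (a : TangentSpace 𝓘(ℝ, E) x), a ≠ 0 → 0 < g.val x a a) ∨
  (∀ (x : M) (a : TangentSpace 𝓘(ℝ, E) x), a ≠ 0 → g.val x a a < 0)

/-- The pullback `σ^* g`, `(σ^* g)_p(u,v) = g_{σ(p)}(dσ_p u, dσ_p v)`, of a field of bilinear forms
along a map `σ` from (an open subset of) a vector space `F` to `M`. -/
def pullback (g : BilinField E M) (σ : F → M) (p : F) : F →L[ℝ] F →L[ℝ] ℝ :=
  ContinuousLinearMap.bilinearComp (E := E) (F := E) (g (σ p))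
    (mfderiv 𝓘(ℝ, F) 𝓘(ℝ, E) σ p : F →L[ℝ] E) (mfderiv 𝓘(ℝ, F) 𝓘(ℝ, E) σ p : F →L[ℝ] E)

/-- The sectional curvature of `g` at `x` on the plane spanned by `a, b ∈ T_x M`, computed in the
preferred chart at `x`; the differential of this chart at `x` is the identification of `T_x M`
with `E`. It depends only on `g` near `x`. -/
def sectionalCurvature (g : BilinField E M) (x : M) (a b : TangentSpace 𝓘(ℝ, E) x) : ℝ :=
  coordSectionalCurvature (pullback g (extChartAt 𝓘(ℝ, E) x).symm) (extChartAt 𝓘(ℝ, E) x x)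
    (a : E) (b : E)

/-! ### Level sets -/

/-- `σ : U → M_l` is a local parametrization, by an open subset `U` of `F`, of the regular level set
`M_l = {f = l}`: it is smooth with values in `M_l`, and each differential is an isomorphism of `F`
onto `ker df = T M_l`. (By the inverse function theorem `σ` is a local diffeomorphism onto an open
subset of the submanifold `M_l`.) -/
structure IsLevelParametrization (f : M → ℝ) (l : ℝ) (U : Set F) (σ : F → M) : Prop where
  isOpen : IsOpen U
  contMDiffOn : ContMDiffOn 𝓘(ℝ, F) 𝓘(ℝ, E) ∞ σ U
  mapsTo : ∀ p ∈ U, f (σ p) = l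
  injective : ∀ p ∈ U, Function.Injective (mfderiv 𝓘(ℝ, F) 𝓘(ℝ, E) σ p)
  range_eq : ∀ p ∈ U, ∀ a : TangentSpace 𝓘(ℝ, E) (σ p),
    (∃ u : F, mfderiv 𝓘(ℝ, F) 𝓘(ℝ, E) σ p u = a) ↔ mfderiv 𝓘(ℝ, E) 𝓘(ℝ, ℝ) f (σ p) a = 0

/-- All sectional curvatures of the metric `g_l` induced by `g` on the level set `M_l = {f = l}`
satisfy `Q`. The sectional curvatures of `g_l` are those of `σ^* g = σ^* g_l` in the coordinates
given by local parametrizations `σ` of `M_l`. Here `F` is the model space of `M_l`. -/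
def LevelSectionalCurvature (F : Type*) [NormedAddCommGroup F] [NormedSpace ℝ F]
    (g : BilinField E M) (f : M → ℝ) (l : ℝ) (Q : ℝ → Prop) : Prop :=
  ∀ (U : Set F) (σ : F → M), IsLevelParametrization (E := E) f l U σ →
    ∀ p ∈ U, ∀ u v : F, LinearIndependent ℝ ![u, v] →
      Q (coordSectionalCurvature (pullback g σ) p u v)

/-! ### Homogeneous pairs -/

/-- A smooth free action of the multiplicative group of positive reals; `m t` is the action of `t`
and its values for `t ≤ 0` are irrelevant. -/
structure IsFreePosAction (E : Type*) [NormedAddCommGroup E] [NormedSpace ℝ E]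
    {M : Type*} [TopologicalSpace M] [ChartedSpace E M] (m : ℝ → M → M) : Prop where
  contMDiffOn : ContMDiffOn (𝓘(ℝ, ℝ).prod 𝓘(ℝ, E)) 𝓘(ℝ, E) ∞
    (fun q : ℝ × M => m q.1 q.2) (Ioi 0 ×ˢ univ)
  one : ∀ x, m 1 x = x
  mul : ∀ s t : ℝ, 0 < s → 0 < t → ∀ x, m (s * t) x = m s (m t x)
  free : ∀ t : ℝ, 0 < t → ∀ x, m t x = x → t = 1

/-- The vector field `P_x = d/dt|_{t=0} m(e^t, x)` generated by the action. -/
def generator (E : Type*) [NormedAddCommGroup E] [NormedSpace ℝ E]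
    {M : Type*} [TopologicalSpace M] [ChartedSpace E M] (m : ℝ → M → M) (x : M) :
    TangentSpace 𝓘(ℝ, E) x :=
  (mfderiv 𝓘(ℝ, ℝ) 𝓘(ℝ, E) (fun t : ℝ => m (Real.exp t) x) 0 : ℝ →L[ℝ] E) 1

/-- `(g, f)` is a homogeneous pair of degree `α` for the action `m`. -/
structure IsHomogeneousPair [IsManifold 𝓘(ℝ, E) ∞ M] (m : ℝ → M → M)
    (g : PseudoRiemannianMetric E M) (f : M → ℝ) (α : ℝ) : Prop where
  action : IsFreePosAction E m
  degree_ne_zero : α ≠ 0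
  contMDiff : ContMDiff 𝓘(ℝ, E) 𝓘(ℝ, ℝ) ∞ f
  pos : ∀ x, 0 < f x
  homog_metric : ∀ t : ℝ, 0 < t → ∀ (x : M) (a b : TangentSpace 𝓘(ℝ, E) x),
    g.val (m t x) (mfderiv 𝓘(ℝ, E) 𝓘(ℝ, E) (m t) x a) (mfderiv 𝓘(ℝ, E) 𝓘(ℝ, E) (m t) x b)
      = t ^ α * g.val x a b
  homog_fun : ∀ t : ℝ, 0 < t → ∀ x, f (m t x) = t ^ α * f x
  metric_generator : ∀ (x : M) (a : TangentSpace 𝓘(ℝ, E) x),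
    g.val x (generator E m x) a = mfderiv 𝓘(ℝ, E) 𝓘(ℝ, ℝ) f x a

end Manifold

/-! ### The functions `w` -/

/-- The parameter set `Δ₁ ∪ Δ₂ ∪ Δ₃`. -/
def IsAdmissible (s C₁ : ℝ) : Prop :=
  (0 < s ∧ 0 < C₁) ∨ (s = 0 ∧ 0 ≤ C₁) ∨ (s < 0 ∧ C₁ ≤ 0)

/-- The function `w(s, C₁, C₂, r)`; `ε = ±1` is the sign in the exponent in the case `s = 0` and
plays no role otherwise. -/
def w (ε s C₁ C₂ r : ℝ) : ℝ :=
  if 0 < s then C₁ / (s * Real.cosh (√C₁ * (Real.log r + C₂)) ^ 2)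
  else if s = 0 then Real.exp C₂ * r ^ (ε * (2 * √C₁))
  else if C₁ < 0 then C₁ / (s * Real.sin (√(-C₁) * (Real.log r + C₂)) ^ 2)
  else -1 / (s * (Real.log r + C₂) ^ 2)

/-- The set of `r > 0` where `w(s, C₁, C₂, r)` is defined, i.e. where no denominator vanishes: all
`r > 0` if `s ≥ 0`. -/
def wDomain (s C₁ C₂ : ℝ) : Set ℝ :=
  {r | 0 < r ∧
    (s < 0 → C₁ < 0 → Real.sin (√(-C₁) * (Real.log r + C₂)) ≠ 0) ∧
    (s < 0 → C₁ = 0 → Real.log r + C₂ ≠ 0)}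

end HomogPair

end

noncomputable section

set_option maxSynthPendingDepth 3

/-! Let `P` be the generator. Homogeneity of `f` gives Euler's identity `df(P) = α f`, so `f` has no
critical points and every orbit meets `M_l`. Take a local parametrization `σ` of `M_l` and use the
flow coordinates `(τ, p) ↦ m (e^τ) (σ p)`. There `f = l e^{ατ}`; `g(P, ·) = df` makes `P` orthogonal
to the level sets with `g(P, P) = α f`; and `m_λ^* g = λ^α g` transports `g_l` along the orbits.
Hence `g = e^{ατ} (α l dτ² + g_l)`, and `(v ∘ f) g = W(τ) (κ dτ² + h)` with `κ = α l`, `h = g_l` and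
`W = v(f) e^{ατ} = w(f) / l`: a metric conformal to a product, with factor depending on `τ` alone.

Put `ψ = W' / (2W)`. The curvature numerator of such a metric (`coordCurvature_warped`) is `W` times
the numerator for `h`, corrected by a `ψ'` term and a `ψ²` term. The functions `w` are chosen so
that `ψ' = -κ C W` and `ψ² = κ (D - C W)` with `D = α C₁ / l` (`exists_half_logDeriv_w`, rescaled in
`exists_warping_function`). Subtracting `C` times the Gram determinant then cancels every term
except `W (R_h - D · Gram_h)`, where `R_h` is the curvature numerator of `h` and `Gram_h` its Gram
determinant on the projected vectors. If the projections to `F` are independent, `K - C` is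
therefore a nonnegative multiple of `K^h - D`; if they are dependent, `K = C`. The multiple is
nonnegative because definite forms of either sign have positive Gram determinants. All three
assertions follow (`coordSectionalCurvature_warped`).

Since sectional curvature is defined in the preferred chart, its invariance under coordinate changes
(`coordSectionalCurvature_pullback`) is needed to pass to flow coordinates. The parametrizations `σ`
come from the inverse function theorem. -/

namespace HomogPair

/-! ### Christoffel maps, curvature, and their behaviour under coordinate changes. -/

section Coordinates

open ContinuousLinearMap Filter Topology

variable {F : Type*} [NormedAddCommGroup F] [NormedSpace ℝ F]
  {F' : Type*} [NormedAddCommGroup F'] [NormedSpace ℝ F']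

/-- The linear operation on trilinear forms underlying the Koszul formula. -/
def koszulMap (T : F →L[ℝ] F →L[ℝ] F →L[ℝ] ℝ) : F →L[ℝ] F →L[ℝ] F →L[ℝ] ℝ :=
  (1 / 2 : ℝ) • (T + flipₗᵢ ℝ F F (F →L[ℝ] ℝ) T -
    compL ℝ F (F →L[ℝ] F →L[ℝ] ℝ) (F →L[ℝ] F →L[ℝ] ℝ)
      (flipₗᵢ ℝ F F ℝ).toContinuousLinearEquiv.toContinuousLinearMap
      (flipₗᵢ ℝ F F (F →L[ℝ] ℝ) T))

theorem contDiff_koszulMap : ContDiff ℝ ∞ (koszulMap (F := F)) := by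
  have h := (flipₗᵢ ℝ F F (F →L[ℝ] ℝ)).contDiff (n := ∞)
  exact (ContDiff.sub (contDiff_id.add h) ((ContinuousLinearMap.contDiff _).comp h)).const_smul _

theorem koszulMap_apply (G : F → F →L[ℝ] F →L[ℝ] ℝ) (p u v : F) :
    koszulMap (fderiv ℝ G p) u v = koszul G p u v := by
  ext w
  simp [koszulMap, koszul, ContinuousLinearMap.flip_apply]

/-- The Christoffel map as a field of continuous bilinear maps. -/
def christoffelMap (G : F → F →L[ℝ] F →L[ℝ] ℝ) (p : F) : F →L[ℝ] F →L[ℝ] F :=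
  compL ℝ F (F →L[ℝ] F →L[ℝ] ℝ) (F →L[ℝ] F)
    (compL ℝ F (F →L[ℝ] ℝ) F (G p).inverse) (koszulMap (fderiv ℝ G p))

theorem christoffelMap_apply (G : F → F →L[ℝ] F →L[ℝ] ℝ) (p u v : F) :
    christoffelMap G p u v = christoffel G p u v := by
  simp [christoffelMap, christoffel, ← koszulMap_apply]

/-- The Christoffel map is composed of the linear Koszul operation on `fderiv ℝ G` and operator
inversion, which is smooth at invertible operators between complete spaces. -/
theorem contDiffAt_christoffelMap [CompleteSpace F] {G : F → F →L[ℝ] F →L[ℝ] ℝ} {p : F}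
    (hG : ContDiffAt ℝ ∞ G p) (hi : (G p).IsInvertible) :
    ContDiffAt ℝ ∞ (christoffelMap G) p := by
  have h1 : ContDiffAt ℝ ∞ (fun q => (G q).inverse) p :=
    ContDiffAt.comp (g := ContinuousLinearMap.inverse) p hi.contDiffAt_map_inverse hG
  have h2 : ContDiffAt ℝ ∞ (fun q => koszulMap (fderiv ℝ G q)) p :=
    contDiff_koszulMap.contDiffAt.comp p (hG.fderiv_right (by simp))
  have h3 : ContDiffAt ℝ ∞ (fun q => compL ℝ F (F →L[ℝ] ℝ) F (G q).inverse) p :=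
    (ContinuousLinearMap.contDiff _).contDiffAt.comp p h1
  have h4 : ContDiffAt ℝ ∞ (fun q => compL ℝ F (F →L[ℝ] F →L[ℝ] ℝ) (F →L[ℝ] F)
      (compL ℝ F (F →L[ℝ] ℝ) F (G q).inverse)) p :=
    (ContinuousLinearMap.contDiff _).contDiffAt.comp p h3
  exact h4.clm_apply h2

theorem apply_christoffel {G : F → F →L[ℝ] F →L[ℝ] ℝ} {p : F} (hi : (G p).IsInvertible)
    (u v : F) : G p (christoffel G p u v) = koszul G p u v :=
  hi.self_apply_inverse _

theorem koszul_apply (G : F → F →L[ℝ] F →L[ℝ] ℝ) (p u v w : F) :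
    koszul G p u v w =
      1 / 2 * (fderiv ℝ G p u v w + fderiv ℝ G p v u w - fderiv ℝ G p w u v) := by
  simp [koszul, ContinuousLinearMap.flip_apply]

theorem fderiv_apply_apply {G : F → F' →L[ℝ] F' →L[ℝ] ℝ} {p : F} (hG : DifferentiableAt ℝ G p)
    (x : F) (u v : F') : fderiv ℝ (fun q => G q u v) p x = fderiv ℝ G p x u v := by
  have h := (hG.hasFDerivAt.clm_apply (hasFDerivAt_const u p)).clm_apply (hasFDerivAt_const v p)
  rw [h.fderiv]
  simp [ContinuousLinearMap.flip_apply]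

/-- Derivative of a bilinear map field evaluated on vector fields. -/
theorem fderiv_bilin_apply {X Y Z : Type*} [NormedAddCommGroup X] [NormedSpace ℝ X]
    [NormedAddCommGroup Y] [NormedSpace ℝ Y] [NormedAddCommGroup Z] [NormedSpace ℝ Z]
    {B : X → Y →L[ℝ] Y →L[ℝ] Z} {V W : X → Y} {p : X} (hB : DifferentiableAt ℝ B p)
    (hV : DifferentiableAt ℝ V p) (hW : DifferentiableAt ℝ W p) (x : X) :
    fderiv ℝ (fun q => B q (V q) (W q)) p x =
      fderiv ℝ B p x (V p) (W p) + B p (fderiv ℝ V p x) (W p) + B p (V p) (fderiv ℝ W p x) := by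
  have h := (hB.hasFDerivAt.clm_apply hV.hasFDerivAt).clm_apply hW.hasFDerivAt
  rw [h.fderiv]
  simp [ContinuousLinearMap.flip_apply]
  abel

theorem coordCurvature_eq [CompleteSpace F] {G : F → F →L[ℝ] F →L[ℝ] ℝ} {p : F}
    (hG : ContDiffAt ℝ ∞ G p) (hi : (G p).IsInvertible) (u v w : F) :
    coordCurvature G p u v w =
      fderiv ℝ (christoffelMap G) p u v w - fderiv ℝ (christoffelMap G) p v u w
      + christoffel G p u (christoffel G p v w) - christoffel G p v (christoffel G p u w) := by
  have hd := (contDiffAt_christoffelMap hG hi).differentiableAt (by simp)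
  have key : ∀ a b : F, fderiv ℝ (fun q => christoffel G q a w) p b =
      fderiv ℝ (christoffelMap G) p b a w := by
    intro a b
    simp_rw [← christoffelMap_apply]
    rw [fderiv_bilin_apply hd (differentiableAt_const a) (differentiableAt_const w)]
    simp
  simp only [coordCurvature, key]

/-- Transformation of the Christoffel map under a change of coordinates `ψ`. -/
theorem fderiv_christoffel_pullback {G : F → F →L[ℝ] F →L[ℝ] ℝ}
    {G' : F' → F' →L[ℝ] F' →L[ℝ] ℝ} {ψ : F' → F} {p : F'}
    (hψ : ContDiffAt ℝ ∞ ψ p) (hi : (fderiv ℝ ψ p).IsInvertible)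
    (hG : DifferentiableAt ℝ G (ψ p)) (hGi : (G (ψ p)).IsInvertible) (hG'i : (G' p).IsInvertible)
    (hsymm : ∀ u v, G (ψ p) u v = G (ψ p) v u)
    (heq : G' =ᶠ[𝓝 p] fun q => (G (ψ q)).bilinearComp (fderiv ℝ ψ q) (fderiv ℝ ψ q))
    (hG' : DifferentiableAt ℝ G' p) (u v : F') :
    fderiv ℝ ψ p (christoffel G' p u v) = fderiv ℝ (fderiv ℝ ψ) p u v
      + christoffel G (ψ p) (fderiv ℝ ψ p u) (fderiv ℝ ψ p v) := by
  have hdψ : DifferentiableAt ℝ (fderiv ℝ ψ) p :=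
    (hψ.fderiv_right (m := 1) (by norm_cast)).differentiableAt (by simp)
  have hψd : DifferentiableAt ℝ ψ p := hψ.differentiableAt (by simp)
  have D2 : ∀ a b, fderiv ℝ (fderiv ℝ ψ) p a b = fderiv ℝ (fderiv ℝ ψ) p b a :=
    hψ.isSymmSndFDerivAt (by simp; norm_cast)
  have hev : ∀ a b : F', fderiv ℝ (fun q => fderiv ℝ ψ q b) p a = fderiv ℝ (fderiv ℝ ψ) p a b := by
    intro a b
    rw [(hdψ.hasFDerivAt.clm_apply (hasFDerivAt_const b p)).fderiv]
    simp [ContinuousLinearMap.flip_apply]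
  have key : ∀ x a b, fderiv ℝ G' p x a b =
      fderiv ℝ G (ψ p) (fderiv ℝ ψ p x) (fderiv ℝ ψ p a) (fderiv ℝ ψ p b)
      + G (ψ p) (fderiv ℝ (fderiv ℝ ψ) p x a) (fderiv ℝ ψ p b)
      + G (ψ p) (fderiv ℝ ψ p a) (fderiv ℝ (fderiv ℝ ψ) p x b) := by
    intro x a b
    rw [← fderiv_apply_apply hG']
    have : (fun q => G' q a b) =ᶠ[𝓝 p]
        fun q => (G ∘ ψ) q (fderiv ℝ ψ q a) (fderiv ℝ ψ q b) := by
      filter_upwards [heq] with q hq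
      simp [hq]
    rw [this.fderiv_eq, fderiv_bilin_apply (DifferentiableAt.comp (g := G) p hG hψd)
      (hdψ.clm_apply (differentiableAt_const a)) (hdψ.clm_apply (differentiableAt_const b)),
      hev, hev, fderiv_comp p hG hψd]
    rfl
  -- It suffices to test against the vectors `fderiv ℝ ψ p w`. In the Koszul combination of `key`,
  -- symmetry of the second derivative of `ψ` cancels all of its terms except the one in `(u, v)`,
  -- which occurs twice and absorbs the factor `1/2`.
  apply hGi.injective
  ext w'
  obtain ⟨w, rfl⟩ := hi.surjective w'
  have h0 : G (ψ p) (fderiv ℝ ψ p (christoffel G' p u v)) (fderiv ℝ ψ p w)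
      = G' p (christoffel G' p u v) w := by
    rw [heq.eq_of_nhds]; rfl
  rw [h0, apply_christoffel hG'i, koszul_apply, key, key, key, map_add, add_apply,
    apply_christoffel hGi, koszul_apply, D2 v u, D2 w u, D2 w v,
    hsymm (fderiv ℝ ψ p v), hsymm (fderiv ℝ ψ p u)]
  ring

/-- Naturality of the curvature tensor under a change of coordinates `ψ`. -/
theorem fderiv_coordCurvature_pullback [CompleteSpace F] [CompleteSpace F']
    {G : F → F →L[ℝ] F →L[ℝ] ℝ}
    {G' : F' → F' →L[ℝ] F' →L[ℝ] ℝ} {ψ : F' → F} {p : F'}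
    (hψ : ∀ᶠ q in 𝓝 p, ContDiffAt ℝ ∞ ψ q) (hi : ∀ᶠ q in 𝓝 p, (fderiv ℝ ψ q).IsInvertible)
    (hG : ∀ᶠ q in 𝓝 (ψ p), ContDiffAt ℝ ∞ G q) (hGi : ∀ᶠ q in 𝓝 (ψ p), (G q).IsInvertible)
    (hG' : ∀ᶠ q in 𝓝 p, ContDiffAt ℝ ∞ G' q) (hG'i : ∀ᶠ q in 𝓝 p, (G' q).IsInvertible)
    (hsymm : ∀ᶠ q in 𝓝 (ψ p), ∀ u v, G q u v = G q v u)
    (heq : G' =ᶠ[𝓝 p] fun q => (G (ψ q)).bilinearComp (fderiv ℝ ψ q) (fderiv ℝ ψ q))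
    (u v w : F') :
    fderiv ℝ ψ p (coordCurvature G' p u v w) =
      coordCurvature G (ψ p) (fderiv ℝ ψ p u) (fderiv ℝ ψ p v) (fderiv ℝ ψ p w) := by
  have hψp := hψ.self_of_nhds
  have hGp := hG.self_of_nhds
  have hG'p := hG'.self_of_nhds
  have hGip := hGi.self_of_nhds
  have hG'ip := hG'i.self_of_nhds
  have hc := hψp.continuousAt
  have hψ2 : ContDiffAt ℝ ∞ (fderiv ℝ ψ) p := hψp.fderiv_right (by simp)
  have hψ3 : ContDiffAt ℝ ∞ (fderiv ℝ (fderiv ℝ ψ)) p := hψ2.fderiv_right (by simp)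
  have d1 : DifferentiableAt ℝ ψ p := hψp.differentiableAt (by simp)
  have d2 : DifferentiableAt ℝ (fderiv ℝ ψ) p := hψ2.differentiableAt (by simp)
  have d3 : DifferentiableAt ℝ (fderiv ℝ (fderiv ℝ ψ)) p := hψ3.differentiableAt (by simp)
  have hΓ : DifferentiableAt ℝ (christoffelMap G) (ψ p) :=
    (contDiffAt_christoffelMap hGp hGip).differentiableAt (by simp)
  have hΓ' : DifferentiableAt ℝ (christoffelMap G') p :=
    (contDiffAt_christoffelMap hG'p hG'ip).differentiableAt (by simp)
  have D2 : ∀ a b, fderiv ℝ (fderiv ℝ ψ) p a b = fderiv ℝ (fderiv ℝ ψ) p b a :=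
    hψp.isSymmSndFDerivAt (by simp; norm_cast)
  have D3 : ∀ a b c, fderiv ℝ (fderiv ℝ (fderiv ℝ ψ)) p a b c =
      fderiv ℝ (fderiv ℝ (fderiv ℝ ψ)) p b a c := fun a b c =>
    congrArg (fun L : F' →L[ℝ] F => L c) (hψ2.isSymmSndFDerivAt (by simp; norm_cast) a b)
  -- The transformation law is needed on a neighbourhood, because `key` is its derivative.
  have trans : ∀ᶠ q in 𝓝 p, ∀ a b, fderiv ℝ ψ q (christoffelMap G' q a b) =
      fderiv ℝ (fderiv ℝ ψ) q a b
        + (christoffelMap G ∘ ψ) q (fderiv ℝ ψ q a) (fderiv ℝ ψ q b) := by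
    filter_upwards [hψ, hi, hc.eventually hG, hc.eventually hGi, hG', hG'i, hc.eventually hsymm,
      heq.eventually_nhds] with q h1 h2 h3 h4 h5 h6 h7 h8 a b
    rw [Function.comp_apply, christoffelMap_apply, christoffelMap_apply]
    exact fderiv_christoffel_pullback h1 h2 (h3.differentiableAt (by simp)) h4 h6 h7 h8
      (h5.differentiableAt (by simp)) a b
  have tp := trans.self_of_nhds
  have hev : ∀ a b : F', fderiv ℝ (fun q => fderiv ℝ ψ q b) p a = fderiv ℝ (fderiv ℝ ψ) p a b := by
    intro a b
    rw [(d2.hasFDerivAt.clm_apply (hasFDerivAt_const b p)).fderiv]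
    simp [ContinuousLinearMap.flip_apply]
  have key : ∀ a b c : F',
      fderiv ℝ (fderiv ℝ ψ) p a (christoffelMap G' p b c)
        + fderiv ℝ ψ p (fderiv ℝ (christoffelMap G') p a b c) =
      fderiv ℝ (fderiv ℝ (fderiv ℝ ψ)) p a b c
        + (fderiv ℝ (christoffelMap G) (ψ p) (fderiv ℝ ψ p a) (fderiv ℝ ψ p b) (fderiv ℝ ψ p c)
          + christoffelMap G (ψ p) (fderiv ℝ (fderiv ℝ ψ) p a b) (fderiv ℝ ψ p c)
          + christoffelMap G (ψ p) (fderiv ℝ ψ p b) (fderiv ℝ (fderiv ℝ ψ) p a c)) := by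
    intro a b c
    have hE : (fun q => fderiv ℝ ψ q (christoffelMap G' q b c)) =ᶠ[𝓝 p] fun q =>
        fderiv ℝ (fderiv ℝ ψ) q b c
        + (christoffelMap G ∘ ψ) q (fderiv ℝ ψ q b) (fderiv ℝ ψ q c) := by
      filter_upwards [trans] with q hq using hq b c
    have hF := congrArg (fun L : F' →L[ℝ] F => L a) hE.fderiv_eq
    have e1 : DifferentiableAt ℝ (fun q => christoffelMap G' q b c) p :=
      (hΓ'.clm_apply (differentiableAt_const b)).clm_apply (differentiableAt_const c)
    have e2 : DifferentiableAt ℝ (fun q => fderiv ℝ ψ q b) p :=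
      d2.clm_apply (differentiableAt_const b)
    have e3 : DifferentiableAt ℝ (fun q => fderiv ℝ ψ q c) p :=
      d2.clm_apply (differentiableAt_const c)
    have e4 : DifferentiableAt ℝ (fun q => fderiv ℝ (fderiv ℝ ψ) q b c) p :=
      (d3.clm_apply (differentiableAt_const b)).clm_apply (differentiableAt_const c)
    have e5 : DifferentiableAt ℝ (christoffelMap G ∘ ψ) p := hΓ.comp p d1
    have e6 := (e5.clm_apply e2).clm_apply e3
    rw [(d2.hasFDerivAt.clm_apply e1.hasFDerivAt).fderiv, fderiv_fun_add e4 e6] at hF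
    simp only [add_apply, ContinuousLinearMap.comp_apply, ContinuousLinearMap.flip_apply] at hF
    rw [fderiv_bilin_apply e5 e2 e3, hev, hev, fderiv_comp p hΓ d1,
      fderiv_bilin_apply hΓ' (differentiableAt_const b) (differentiableAt_const c),
      fderiv_bilin_apply d3 (differentiableAt_const b) (differentiableAt_const c)] at hF
    simp only [fderiv_fun_const, Pi.zero_apply, zero_apply, map_zero, add_zero,
      ContinuousLinearMap.comp_apply, Function.comp_apply] at hF
    rw [← hF, add_comm]
  rw [coordCurvature_eq hGp hGip, coordCurvature_eq hG'p hG'ip]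
  simp only [← christoffelMap_apply, map_sub, map_add]
  -- Antisymmetrizing `key` in `u, v` removes the third derivatives of `ψ` and the terms with its
  -- second derivative at `(u, v)`. The other second derivatives cancel against those in `t1` and
  -- `t2`, the transformation law applied to the inner Christoffel vectors.
  have k1 := key u v w
  have k2 := key v u w
  have t1 := tp u (christoffelMap G' p v w)
  have t2 := tp v (christoffelMap G' p u w)
  have t3 := tp v w
  have t4 := tp u w
  simp only [Function.comp_apply] at t1 t2 t3 t4
  rw [t3, map_add] at t1
  rw [t4, map_add] at t2
  rw [D3 u v w, D2 u v] at k1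
  rw [t1, t2]
  have k1' := eq_sub_of_add_eq' k1
  have k2' := eq_sub_of_add_eq' k2
  rw [k1', k2']
  abel

theorem coordSectionalCurvature_pullback [CompleteSpace F] [CompleteSpace F']
    {G : F → F →L[ℝ] F →L[ℝ] ℝ}
    {G' : F' → F' →L[ℝ] F' →L[ℝ] ℝ} {ψ : F' → F} {p : F'}
    (hψ : ∀ᶠ q in 𝓝 p, ContDiffAt ℝ ∞ ψ q) (hi : ∀ᶠ q in 𝓝 p, (fderiv ℝ ψ q).IsInvertible)
    (hG : ∀ᶠ q in 𝓝 (ψ p), ContDiffAt ℝ ∞ G q) (hGi : ∀ᶠ q in 𝓝 (ψ p), (G q).IsInvertible)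
    (hG' : ∀ᶠ q in 𝓝 p, ContDiffAt ℝ ∞ G' q) (hG'i : ∀ᶠ q in 𝓝 p, (G' q).IsInvertible)
    (hsymm : ∀ᶠ q in 𝓝 (ψ p), ∀ u v, G q u v = G q v u)
    (heq : G' =ᶠ[𝓝 p] fun q => (G (ψ q)).bilinearComp (fderiv ℝ ψ q) (fderiv ℝ ψ q))
    (u v : F') :
    coordSectionalCurvature G (ψ p) (fderiv ℝ ψ p u) (fderiv ℝ ψ p v) =
      coordSectionalCurvature G' p u v := by
  simp only [coordSectionalCurvature]
  rw [← fderiv_coordCurvature_pullback hψ hi hG hGi hG' hG'i hsymm heq, heq.eq_of_nhds]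
  rfl

end Coordinates

/-! ### Curvature of metrics conformal to a product with a line. -/

section Warped

open ContinuousLinearMap Filter Topology

variable {F : Type*} [NormedAddCommGroup F] [NormedSpace ℝ F]

theorem bilinearComp_contDiffAt {X Y Z : Type*} [NormedAddCommGroup X] [NormedSpace ℝ X]
    [NormedAddCommGroup Y] [NormedSpace ℝ Y] [NormedAddCommGroup Z] [NormedSpace ℝ Z]
    {B : X → Y →L[ℝ] Y →L[ℝ] ℝ} {A : X → Z →L[ℝ] Y} {p : X} {n : WithTop ℕ∞}
    (hB : ContDiffAt ℝ n B p) (hA : ContDiffAt ℝ n A p) :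
    ContDiffAt ℝ n (fun q => (B q).bilinearComp (A q) (A q)) p := by
  have h1 : ContDiffAt ℝ n (fun q => flipₗᵢ ℝ Z Y ℝ ((B q).comp (A q))) p :=
    (flipₗᵢ ℝ Z Y ℝ).contDiff.contDiffAt.comp p (hB.clm_comp hA)
  have h2 : ContDiffAt ℝ n
      (fun q => flipₗᵢ ℝ Z Z ℝ ((flipₗᵢ ℝ Z Y ℝ ((B q).comp (A q))).comp (A q))) p :=
    (flipₗᵢ ℝ Z Z ℝ).contDiff.contDiffAt.comp p (h1.clm_comp hA)
  exact h2

/-- The metric `W(τ) (κ dτ² + h)` on `ℝ × F`. -/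
def warped (κ : ℝ) (W : ℝ → ℝ) (h : F → F →L[ℝ] F →L[ℝ] ℝ) (q : ℝ × F) :
    (ℝ × F) →L[ℝ] (ℝ × F) →L[ℝ] ℝ :=
  W q.1 • (κ • (ContinuousLinearMap.fst ℝ ℝ F).smulRight (ContinuousLinearMap.fst ℝ ℝ F) +
    (h q.2).bilinearComp (ContinuousLinearMap.snd ℝ ℝ F) (ContinuousLinearMap.snd ℝ ℝ F))

theorem warped_apply (κ : ℝ) (W : ℝ → ℝ) (h : F → F →L[ℝ] F →L[ℝ] ℝ) (q U V : ℝ × F) :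
    warped κ W h q U V = W q.1 * (κ * (U.1 * V.1) + h q.2 U.2 V.2) := by
  simp [warped, mul_add]

variable {κ : ℝ} {W : ℝ → ℝ} {h : F → F →L[ℝ] F →L[ℝ] ℝ} {q : ℝ × F}

theorem contDiffAt_warped (hW : ContDiffAt ℝ ∞ W q.1) (hh : ContDiffAt ℝ ∞ h q.2) :
    ContDiffAt ℝ ∞ (warped κ W h) q := by
  have h1 : ContDiffAt ℝ ∞ (fun x : ℝ × F => W x.1) q := hW.comp q contDiffAt_fst
  have h2 : ContDiffAt ℝ ∞ (fun x : ℝ × F => h x.2) q := hh.comp q contDiffAt_snd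
  exact h1.smul (contDiffAt_const.add (bilinearComp_contDiffAt h2 contDiffAt_const))

theorem fderiv_warped {W' : ℝ} (hW : HasDerivAt W W' q.1) (hh : DifferentiableAt ℝ h q.2)
    (hd : DifferentiableAt ℝ (warped κ W h) q) (X U V : ℝ × F) :
    fderiv ℝ (warped κ W h) q X U V =
      W' * X.1 * (κ * (U.1 * V.1) + h q.2 U.2 V.2) + W q.1 * fderiv ℝ h q.2 X.2 U.2 V.2 := by
  rw [← fderiv_apply_apply hd]
  simp only [warped_apply]
  have h1 : HasFDerivAt (fun x : ℝ × F => W x.1) (W' • ContinuousLinearMap.fst ℝ ℝ F) q :=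
    hW.comp_hasFDerivAt q hasFDerivAt_fst
  have h2 : HasFDerivAt (fun x : ℝ × F => h x.2)
      ((fderiv ℝ h q.2).comp (ContinuousLinearMap.snd ℝ ℝ F)) q :=
    hh.hasFDerivAt.comp q hasFDerivAt_snd
  have h3 := (h2.clm_apply (hasFDerivAt_const U.2 q)).clm_apply (hasFDerivAt_const V.2 q)
  rw [(h1.fun_mul (h3.const_add (κ * (U.1 * V.1)))).fderiv]
  simp [ContinuousLinearMap.flip_apply]
  ring

/-- The factor enters the Koszul formula only through `W'`, and `W' = 2 ψ W` lets `W` be divided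
out: what remains is the product connection plus terms linear in `ψ`. Testing against both summands
of `ℝ × F` identifies the vector. -/
theorem christoffel_warped {ψ : ℝ → ℝ} (hκ : κ ≠ 0) (hW : HasDerivAt W (2 * ψ q.1 * W q.1) q.1)
    (hh : DifferentiableAt ℝ h q.2) (hd : DifferentiableAt ℝ (warped κ W h) q)
    (hi : (h q.2).IsInvertible) (hwi : (warped κ W h q).IsInvertible) (U V : ℝ × F) :
    christoffel (warped κ W h) q U V =
      (ψ q.1 * (U.1 * V.1 - h q.2 U.2 V.2 / κ),
        christoffel h q.2 U.2 V.2 + ψ q.1 • (U.1 • V.2 + V.1 • U.2)) := by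
  apply hwi.injective
  ext Z
  · simp [apply_christoffel hwi, koszul_apply, fderiv_warped hW hh hd, warped_apply]
    field_simp
    ring
  · simp [apply_christoffel hwi, koszul_apply, fderiv_warped hW hh hd, warped_apply,
      apply_christoffel hi]
    ring

theorem fderiv_symm {p : F} (hh : DifferentiableAt ℝ h p)
    (hs : ∀ᶠ x in 𝓝 p, ∀ u v, h x u v = h x v u) (x a b : F) :
    fderiv ℝ h p x a b = fderiv ℝ h p x b a := by
  rw [← fderiv_apply_apply hh, ← fderiv_apply_apply hh]
  have : (fun q => h q a b) =ᶠ[𝓝 p] fun q => h q b a := by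
    filter_upwards [hs] with y hy using hy a b
  rw [this.fderiv_eq]

theorem christoffel_comm {p : F} (hh : DifferentiableAt ℝ h p)
    (hs : ∀ᶠ x in 𝓝 p, ∀ u v, h x u v = h x v u) (u v : F) :
    christoffel h p u v = christoffel h p v u := by
  have : koszul h p u v = koszul h p v u := by
    ext w
    rw [koszul_apply, koszul_apply, fderiv_symm hh hs w u v]
    ring
  rw [christoffel, this, christoffel]

/-- Metric compatibility of the connection: adding the two Koszul formulas leaves only the
derivative in direction `u`. -/
theorem fderiv_eq_christoffel {p : F} (hh : DifferentiableAt ℝ h p) (hi : (h p).IsInvertible)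
    (hs : ∀ᶠ x in 𝓝 p, ∀ u v, h x u v = h x v u) (u v w : F) :
    fderiv ℝ h p u v w = h p (christoffel h p u v) w + h p v (christoffel h p u w) := by
  have sd := fderiv_symm hh hs
  rw [hs.self_of_nhds v, apply_christoffel hi, apply_christoffel hi, koszul_apply, koszul_apply,
    sd v u w, sd w u v, sd u w v]
  ring

/-- The numerator of the sectional curvature of a metric `W(τ) (κ dτ² + h)` with `W' = 2 ψ W`. -/
theorem coordCurvature_warped {ψ : ℝ → ℝ} {ψ' : ℝ} [CompleteSpace F] (hκ : κ ≠ 0)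
    (hW : ∀ᶠ t in 𝓝 q.1, HasDerivAt W (2 * ψ t * W t) t) (hψ : HasDerivAt ψ ψ' q.1)
    (hWs : ∀ᶠ t in 𝓝 q.1, ContDiffAt ℝ ∞ W t)
    (hh : ∀ᶠ x in 𝓝 q.2, ContDiffAt ℝ ∞ h x)
    (hi : ∀ᶠ x in 𝓝 q.2, (h x).IsInvertible)
    (hwi : ∀ᶠ x in 𝓝 q, (warped κ W h x).IsInvertible)
    (hs : ∀ᶠ x in 𝓝 q.2, ∀ u v, h x u v = h x v u) (U V : ℝ × F) :
    warped κ W h q (coordCurvature (warped κ W h) q U V V) U =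
      W q.1 * (h q.2 (coordCurvature h q.2 U.2 V.2 V.2) U.2
        - ψ' * (U.1 ^ 2 * h q.2 V.2 V.2 - 2 * U.1 * V.1 * h q.2 U.2 V.2
          + V.1 ^ 2 * h q.2 U.2 U.2)
        - ψ q.1 ^ 2 / κ * (h q.2 U.2 U.2 * h q.2 V.2 V.2 - h q.2 U.2 V.2 ^ 2)) := by
  have t1 : Tendsto (fun x : ℝ × F => x.1) (𝓝 q) (𝓝 q.1) := continuous_fst.continuousAt
  have t2 : Tendsto (fun x : ℝ × F => x.2) (𝓝 q) (𝓝 q.2) := continuous_snd.continuousAt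
  have hΓ : ∀ᶠ x in 𝓝 q, ∀ X Y, christoffel (warped κ W h) x X Y =
      (ψ x.1 * (X.1 * Y.1 - h x.2 X.2 Y.2 / κ),
        christoffel h x.2 X.2 Y.2 + ψ x.1 • (X.1 • Y.2 + Y.1 • X.2)) := by
    filter_upwards [t1.eventually hW, t1.eventually hWs, t2.eventually hh, t2.eventually hi, hwi]
      with x h1 h2 h3 h4 h5 X Y
    exact christoffel_warped hκ h1 (h3.differentiableAt (by simp))
      ((contDiffAt_warped h2 h3).differentiableAt (by simp)) h4 h5 X Y
  have hΓq := hΓ.self_of_nhds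
  have hhd : DifferentiableAt ℝ h q.2 := hh.self_of_nhds.differentiableAt (by simp)
  have hip := hi.self_of_nhds
  have hsp := hs.self_of_nhds
  have hΓd : DifferentiableAt ℝ (christoffelMap h) q.2 :=
    (contDiffAt_christoffelMap hh.self_of_nhds hip).differentiableAt (by simp)
  have a1 : HasFDerivAt (fun x : ℝ × F => ψ x.1) (ψ' • ContinuousLinearMap.fst ℝ ℝ F) q :=
    hψ.comp_hasFDerivAt q hasFDerivAt_fst
  have der : ∀ X Y Z, fderiv ℝ (fun x => christoffel (warped κ W h) x Y Z) q X =
      (ψ' * X.1 * (Y.1 * Z.1 - h q.2 Y.2 Z.2 / κ) - ψ q.1 * fderiv ℝ h q.2 X.2 Y.2 Z.2 / κ,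
        fderiv ℝ (fun x => christoffel h x Y.2 Z.2) q.2 X.2
          + (ψ' * X.1) • (Y.1 • Z.2 + Z.1 • Y.2)) := by
    intro X Y Z
    have e : (fun x => christoffel (warped κ W h) x Y Z) =ᶠ[𝓝 q] fun x =>
        (ψ x.1 * (Y.1 * Z.1 - h x.2 Y.2 Z.2 / κ),
          christoffel h x.2 Y.2 Z.2 + ψ x.1 • (Y.1 • Z.2 + Z.1 • Y.2)) := by
      filter_upwards [hΓ] with x hx using hx Y Z
    rw [e.fderiv_eq]
    have b1 : HasFDerivAt (fun x : ℝ × F => h x.2)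
        ((fderiv ℝ h q.2).comp (ContinuousLinearMap.snd ℝ ℝ F)) q :=
      hhd.hasFDerivAt.comp q hasFDerivAt_snd
    have b2 := (b1.clm_apply (hasFDerivAt_const Y.2 q)).clm_apply (hasFDerivAt_const Z.2 q)
    have b3 := a1.fun_mul ((b2.mul_const κ⁻¹).const_sub (Y.1 * Z.1))
    have c1 : DifferentiableAt ℝ (fun x => christoffel h x Y.2 Z.2) q.2 := by
      simp_rw [← christoffelMap_apply]
      exact (hΓd.clm_apply (differentiableAt_const _)).clm_apply (differentiableAt_const _)
    have c2 : HasFDerivAt (fun x : ℝ × F => christoffel h x.2 Y.2 Z.2)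
        ((fderiv ℝ (fun x => christoffel h x Y.2 Z.2) q.2).comp
          (ContinuousLinearMap.snd ℝ ℝ F)) q :=
      c1.hasFDerivAt.comp q hasFDerivAt_snd
    have c3 := c2.fun_add (a1.smul_const (Y.1 • Z.2 + Z.1 • Y.2))
    simp_rw [div_eq_mul_inv]
    rw [(b3.prodMk c3).fderiv]
    ext
    · simp [ContinuousLinearMap.flip_apply]
      ring
    · simp
  -- Metric compatibility replaces the derivatives of `h` in the `ℝ`-component by Christoffel terms,
  -- which then cancel with those from the quadratic part of the curvature.
  have hc := fun u v w => fderiv_eq_christoffel hhd hip hs u v w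
  have hadd : ∀ u v w, christoffel h q.2 u (v + w) =
      christoffel h q.2 u v + christoffel h q.2 u w := by
    intro u v w; simp only [← christoffelMap_apply, map_add]
  have hsmul : ∀ (u : F) (c : ℝ) (v : F), christoffel h q.2 u (c • v) =
      c • christoffel h q.2 u v := by
    intro u c v; simp only [← christoffelMap_apply, map_smul]
  have hR : coordCurvature (warped κ W h) q U V V =
      (ψ' * (V.1 * h q.2 U.2 V.2 - U.1 * h q.2 V.2 V.2) / κ,
        coordCurvature h q.2 U.2 V.2 V.2 + (ψ' * V.1) • (U.1 • V.2 - V.1 • U.2)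
          + (ψ q.1 ^ 2 / κ) • (h q.2 U.2 V.2 • V.2 - h q.2 V.2 V.2 • U.2)) := by
    simp only [coordCurvature, der, hΓq, hc]
    ext
    · simp only [Prod.fst_sub, Prod.fst_add, map_add, map_smul, smul_eq_mul, smul_add]
      rw [christoffel_comm hhd hs V.2 U.2, hsp (christoffel h q.2 U.2 V.2) V.2, hsp V.2 U.2]
      ring
    · simp only [Prod.snd_sub, Prod.snd_add, hadd, hsmul, smul_add]
      rw [christoffel_comm hhd hs V.2 U.2]
      module
  rw [hR, warped_apply]
  simp only [map_add, map_sub, map_smul, add_apply, sub_apply, smul_apply, smul_eq_mul]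
  rw [hsp V.2 U.2]
  field_simp
  ring

end Warped

/-! ### Gram determinants and the comparison of sectional curvatures. -/

section WarpedSectional

open Filter Topology

/-- Definiteness of a bilinear form. -/
def FormIsDefinite {X : Type*} [NormedAddCommGroup X] [NormedSpace ℝ X]
    (B : X →L[ℝ] X →L[ℝ] ℝ) : Prop :=
  (∀ a, a ≠ 0 → 0 < B a a) ∨ (∀ a, a ≠ 0 → B a a < 0)

theorem FormIsDefinite.gram_pos {X : Type*} [NormedAddCommGroup X] [NormedSpace ℝ X]
    {B : X →L[ℝ] X →L[ℝ] ℝ} (hB : FormIsDefinite B) (hs : ∀ u v, B u v = B v u) {u v : X}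
    (huv : LinearIndependent ℝ ![u, v]) : 0 < B u u * B v v - B u v ^ 2 := by
  have hv : v ≠ 0 := huv.ne_zero 1
  -- This vector is `B v v` times the component of `u` orthogonal to `v`; its square is `B v v`
  -- times the Gram determinant, so both have the sign of `B`.
  have hne : B v v • u - B u v • v ≠ 0 := by
    intro h0
    have h1 := LinearIndependent.pair_iff.1 huv (B v v) (-B u v) (by rw [neg_smul, ← sub_eq_add_neg, h0])
    rcases hB with hB | hB
    · exact (hB v hv).ne' h1.1
    · exact (hB v hv).ne h1.1
  have key : B (B v v • u - B u v • v) (B v v • u - B u v • v) =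
      B v v * (B u u * B v v - B u v ^ 2) := by
    simp only [map_sub, map_smul, sub_apply, smul_apply,
      smul_eq_mul, hs v u]
    ring
  rcases hB with hB | hB
  · have := hB _ hne
    rw [key] at this
    exact (mul_pos_iff_of_pos_left (hB v hv)).1 this
  · have := hB _ hne
    rw [key] at this
    exact (pos_iff_pos_of_mul_pos (by nlinarith [hB v hv] : 0 < (B u u * B v v - B u v ^ 2) * 1)).2
      one_pos

variable {F : Type*} [NormedAddCommGroup F] [NormedSpace ℝ F]

/-- The curvature tensor is bilinear and antisymmetric in its first two arguments. -/
theorem coordCurvature_of_not_linearIndependent [CompleteSpace F] {h : F → F →L[ℝ] F →L[ℝ] ℝ}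
    {p : F} (hh : ContDiffAt ℝ ∞ h p) (hi : (h p).IsInvertible) {u v : F}
    (huv : ¬ LinearIndependent ℝ ![u, v]) (w : F) : coordCurvature h p u v w = 0 := by
  rw [coordCurvature_eq hh hi]
  simp only [← christoffelMap_apply]
  rw [LinearIndependent.pair_iff] at huv
  push Not at huv
  obtain ⟨s, t, hst, hne⟩ := huv
  by_cases hs : s = 0
  · have ht := hne hs
    rw [hs, zero_smul, zero_add, smul_eq_zero] at hst
    rw [hst.resolve_left ht]
    simp
  · have hu : u = (-(s⁻¹ * t)) • v := by
      have : s • u = -(t • v) := eq_neg_of_add_eq_zero_left hst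
      rw [neg_smul, mul_smul, ← smul_neg, ← this, inv_smul_smul₀ hs]
    rw [hu]
    simp only [map_smul, smul_apply]
    abel

theorem gram_of_not_linearIndependent {B : F →L[ℝ] F →L[ℝ] ℝ} {u v : F}
    (huv : ¬ LinearIndependent ℝ ![u, v]) : B u u * B v v - B u v * B v u = 0 := by
  rw [LinearIndependent.pair_iff] at huv
  push Not at huv
  obtain ⟨s, t, hst, hne⟩ := huv
  by_cases hs : s = 0
  · have ht := hne hs
    rw [hs, zero_smul, zero_add, smul_eq_zero] at hst
    rw [hst.resolve_left ht]
    simp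
  · have hu : u = (-(s⁻¹ * t)) • v := by
      have : s • u = -(t • v) := eq_neg_of_add_eq_zero_left hst
      rw [neg_smul, mul_smul, ← smul_neg, ← this, inv_smul_smul₀ hs]
    rw [hu]
    simp only [map_smul, smul_apply, smul_eq_mul]
    ring

/-- Comparison of the sectional curvatures of `W(τ) (κ dτ² + h)` and `h` when `W` solves the
equations characterising constant curvature. -/
theorem coordSectionalCurvature_warped [CompleteSpace F] {κ C D : ℝ} {W ψ : ℝ → ℝ}
    {h : F → F →L[ℝ] F →L[ℝ] ℝ} {q : ℝ × F} (hκ : κ ≠ 0)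
    (hW : ∀ᶠ t in 𝓝 q.1, HasDerivAt W (2 * ψ t * W t) t)
    (hψ : HasDerivAt ψ (-(κ * C * W q.1)) q.1)
    (hψ2 : ψ q.1 ^ 2 = κ * (D - C * W q.1)) (hWpos : 0 < W q.1)
    (hWs : ∀ᶠ t in 𝓝 q.1, ContDiffAt ℝ ∞ W t)
    (hh : ∀ᶠ x in 𝓝 q.2, ContDiffAt ℝ ∞ h x)
    (hi : ∀ᶠ x in 𝓝 q.2, (h x).IsInvertible)
    (hwi : ∀ᶠ x in 𝓝 q, (warped κ W h x).IsInvertible)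
    (hs : ∀ᶠ x in 𝓝 q.2, ∀ u v, h x u v = h x v u)
    (hdef : FormIsDefinite (warped κ W h q)) {U V : ℝ × F}
    (hUV : LinearIndependent ℝ ![U, V]) :
    coordSectionalCurvature (warped κ W h) q U V = C ∨
      LinearIndependent ℝ ![U.2, V.2] ∧ ∃ c, 0 ≤ c ∧
        coordSectionalCurvature (warped κ W h) q U V - C =
          c * (coordSectionalCurvature h q.2 U.2 V.2 - D) := by
  have hsp := hs.self_of_nhds
  have hGs : ∀ u v, warped κ W h q u v = warped κ W h q v u := by
    intro u v
    rw [warped_apply, warped_apply, hsp u.2 v.2, mul_comm u.1]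
  have hgram := hdef.gram_pos hGs hUV
  have hnum := coordCurvature_warped hκ hW hψ hWs hh hi hwi hs U V
  rw [hψ2, mul_div_cancel_left₀ _ hκ] at hnum
  -- Expanding the Gram determinant of the warped form, its mixed `ℝ`–`F` part is matched by the
  -- `ψ'` term and its `F` part by the `C W` in `ψ²`; only the `D` term survives.
  have hdiff : coordSectionalCurvature (warped κ W h) q U V - C =
      W q.1 * (h q.2 (coordCurvature h q.2 U.2 V.2 V.2) U.2
        - D * (h q.2 U.2 U.2 * h q.2 V.2 V.2 - h q.2 U.2 V.2 ^ 2)) /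
      (warped κ W h q U U * warped κ W h q V V - warped κ W h q U V ^ 2) := by
    rw [coordSectionalCurvature, hnum, eq_div_iff hgram.ne', sub_mul, div_mul_cancel₀ _ hgram.ne']
    simp only [warped_apply]
    ring
  by_cases hli : LinearIndependent ℝ ![U.2, V.2]
  · right
    refine ⟨hli, W q.1 * (h q.2 U.2 U.2 * h q.2 V.2 V.2 - h q.2 U.2 V.2 ^ 2) /
      (warped κ W h q U U * warped κ W h q V V - warped κ W h q U V ^ 2), ?_, ?_⟩
    all_goals
      have hhdef : FormIsDefinite (h q.2) := by
        have e : ∀ a, warped κ W h q (0, a) (0, a) = W q.1 * h q.2 a a := by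
          intro a; simp [warped_apply]
        rcases hdef with hd | hd
        · left
          intro a ha
          have := hd (0, a) (by simpa using ha)
          rw [e] at this
          exact (mul_pos_iff_of_pos_left hWpos).1 this
        · right
          intro a ha
          have := hd (0, a) (by simpa using ha)
          rw [e] at this
          by_contra hcon
          exact absurd this (not_lt.2 (mul_nonneg hWpos.le (not_lt.1 hcon)))
      have hg2 := hhdef.gram_pos hsp hli
    · positivity
    · rw [hdiff, coordSectionalCurvature]
      field_simp
  -- A plane with degenerate projection to `F` contains the `τ` direction; the numerator of `hdiff`
  -- vanishes, so no information on `h` is required.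
  · left
    rw [← sub_eq_zero, hdiff,
      coordCurvature_of_not_linearIndependent hh.self_of_nhds hi.self_of_nhds hli]
    have := gram_of_not_linearIndependent (B := h q.2) hli
    rw [hsp V.2 U.2] at this
    rw [pow_two, this]
    simp

end WarpedSectional

/-! ### The differential equations satisfied by `w`. -/

section Profile

open Filter Topology Real

theorem isOpen_wDomain (s C₁ C₂ : ℝ) : IsOpen (wDomain s C₁ C₂) := by
  have h1 : ContinuousOn (fun r : ℝ => Real.sin (√(-C₁) * (Real.log r + C₂))) (Ioi 0) := by
    refine Real.continuous_sin.comp_continuousOn (continuousOn_const.mul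
      (ContinuousOn.add (continuousOn_log.mono ?_) continuousOn_const))
    intro x hx; exact (ne_of_gt hx)
  have h2 : ContinuousOn (fun r : ℝ => Real.log r + C₂) (Ioi 0) := by
    refine ContinuousOn.add (continuousOn_log.mono ?_) continuousOn_const
    intro x hx; exact (ne_of_gt hx)
  by_cases hs : s < 0
  · rcases lt_trichotomy C₁ 0 with hC | hC | hC
    · convert h1.isOpen_inter_preimage isOpen_Ioi (isOpen_compl_singleton (x := (0 : ℝ))) using 1
      ext r; simp [wDomain, hs, hC, hC.ne]
    · convert h2.isOpen_inter_preimage isOpen_Ioi (isOpen_compl_singleton (x := (0 : ℝ))) using 1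
      ext r; simp [wDomain, hs, hC]
    · convert isOpen_Ioi (a := (0 : ℝ)) using 1
      ext r; simp [wDomain, hC.not_gt, hC.ne']
  · convert isOpen_Ioi (a := (0 : ℝ)) using 1
    ext r; simp [wDomain, hs]

/-- The function `ρ ↦ w(e^ρ)` is smooth and positive, and its logarithmic derivative `2 φ` satisfies
`φ' = -s w` and `φ² = C₁ - s w`. -/
theorem exists_half_logDeriv_w {ε s C₁ C₂ : ℝ} (hε : ε = 1 ∨ ε = -1) (hadm : IsAdmissible s C₁) :
    ∃ φ : ℝ → ℝ, ∀ ρ, Real.exp ρ ∈ wDomain s C₁ C₂ →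
      HasDerivAt (fun ρ => w ε s C₁ C₂ (Real.exp ρ))
        (2 * φ ρ * w ε s C₁ C₂ (Real.exp ρ)) ρ ∧
      HasDerivAt φ (-(s * w ε s C₁ C₂ (Real.exp ρ))) ρ ∧
      φ ρ ^ 2 = C₁ - s * w ε s C₁ C₂ (Real.exp ρ) ∧
      0 < w ε s C₁ C₂ (Real.exp ρ) ∧
      ContDiffAt ℝ ∞ (w ε s C₁ C₂) (Real.exp ρ) := by
  have hlog : ∀ ρ, ContDiffAt ℝ ∞ (fun r => Real.log r + C₂) (Real.exp ρ) := fun ρ =>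
    (Real.contDiffAt_log.2 (Real.exp_ne_zero ρ)).add contDiffAt_const
  have hlin : ∀ c ρ : ℝ, HasDerivAt (fun ρ => c * (ρ + C₂)) c ρ := by
    intro c ρ
    simpa using ((hasDerivAt_id ρ).add_const C₂).const_mul c
  rcases hadm with ⟨hs, hC⟩ | ⟨hs, hC⟩ | ⟨hs, hC⟩
  · have hw : w ε s C₁ C₂ = fun r =>
        C₁ / (s * Real.cosh (√C₁ * (Real.log r + C₂)) ^ 2) := by
      funext r; simp [w, hs]
    set c := √C₁ with hc
    have hc2 : c ^ 2 = C₁ := Real.sq_sqrt hC.le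
    -- With `ρ = log r`, half the logarithmic derivative of `w` is `-c tanh (c (ρ + C₂))`; both
    -- equations reduce to `cosh² = 1 + sinh²`.
    refine ⟨fun ρ => -(c * (Real.sinh (c * (ρ + C₂)) / Real.cosh (c * (ρ + C₂)))), fun ρ _ => ?_⟩
    have hch := (Real.cosh_pos (c * (ρ + C₂))).ne'
    have d1 := (hlin c ρ).cosh
    have d2 := (hlin c ρ).sinh
    have hid := Real.cosh_sq (c * (ρ + C₂))
    simp only [hw, Real.log_exp]
    refine ⟨?_, ?_, ?_, ?_, ?_⟩
    · refine ((hasDerivAt_const ρ C₁).fun_div ((d1.fun_pow 2).const_mul s)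
        (mul_ne_zero hs.ne' (pow_ne_zero 2 hch))).congr_deriv ?_
      simp
      field_simp
    · refine ((d2.fun_div d1 hch).const_mul c).neg.congr_deriv ?_
      rw [← hc2]
      field_simp
      linear_combination (-c ^ 2) * hid
    · rw [← hc2]
      field_simp
      linear_combination (-c ^ 2) * hid
    · positivity
    · exact contDiffAt_const.div (contDiffAt_const.mul
        ((Real.contDiff_cosh.contDiffAt.comp _ (contDiffAt_const.mul (hlog ρ))).pow 2))
        (by rw [Real.log_exp]; positivity)
  · subst hs
    have hw : w ε 0 C₁ C₂ = fun r => Real.exp C₂ * r ^ (ε * (2 * √C₁)) := by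
      funext r; simp [w]
    have hε2 : ε ^ 2 = 1 := by rcases hε with rfl | rfl <;> norm_num
    -- For `s = 0` the equations say that `φ` is constant with square `C₁`, which either sign `ε`
    -- satisfies.
    refine ⟨fun ρ => ε * √C₁, fun ρ _ => ⟨?_, ?_, ?_, ?_, ?_⟩⟩
    · simp only [hw, ← Real.exp_mul]
      refine ((((hasDerivAt_id ρ).mul_const (ε * (2 * √C₁))).exp).const_mul
        (Real.exp C₂)).congr_deriv ?_
      simp; ring
    · simpa using hasDerivAt_const ρ (ε * √C₁)
    · rw [mul_pow, hε2, Real.sq_sqrt hC]; ring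
    · rw [hw]; positivity
    · rw [hw]
      exact contDiffAt_const.mul (Real.contDiffAt_rpow_const_of_ne (Real.exp_ne_zero ρ))
  · rcases hC.lt_or_eq with hC | hC
    · have hw : w ε s C₁ C₂ = fun r =>
          C₁ / (s * Real.sin (√(-C₁) * (Real.log r + C₂)) ^ 2) := by
        funext r; simp [w, hs.not_gt, hs.ne, hC]
      set c := √(-C₁) with hc
      have hc2 : c ^ 2 = -C₁ := Real.sq_sqrt (by linarith)
      -- The trigonometric analogue of `-c tanh` is `-c cot`, with `C₁ = -c²`.
      refine ⟨fun ρ => -(c * (Real.cos (c * (ρ + C₂)) / Real.sin (c * (ρ + C₂)))), fun ρ hρ => ?_⟩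
      have hsn : Real.sin (c * (ρ + C₂)) ≠ 0 := by
        have := hρ.2.1 hs hC
        rwa [Real.log_exp] at this
      have d1 := (hlin c ρ).sin
      have d2 := (hlin c ρ).cos
      have hid := Real.sin_sq_add_cos_sq (c * (ρ + C₂))
      have hC' : C₁ = -c ^ 2 := by linarith
      simp only [hw, Real.log_exp]
      refine ⟨?_, ?_, ?_, ?_, ?_⟩
      · refine ((hasDerivAt_const ρ C₁).fun_div ((d1.fun_pow 2).const_mul s)
          (mul_ne_zero hs.ne (pow_ne_zero 2 hsn))).congr_deriv ?_
        have := hs.ne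
        simp
        field_simp
      · refine ((d2.fun_div d1 hsn).const_mul c).neg.congr_deriv ?_
        have := hs.ne
        rw [hC']
        field_simp
        linear_combination (c ^ 2) * hid
      · have := hs.ne
        rw [hC']
        field_simp
        linear_combination (c ^ 2) * hid
      · have : 0 < Real.sin (c * (ρ + C₂)) ^ 2 := by positivity
        exact div_pos_of_neg_of_neg hC (mul_neg_of_neg_of_pos hs this)
      · exact contDiffAt_const.div (contDiffAt_const.mul
          ((Real.contDiff_sin.contDiffAt.comp _ (contDiffAt_const.mul (hlog ρ))).pow 2))
          (by rw [Real.log_exp]; exact mul_ne_zero hs.ne (pow_ne_zero 2 hsn))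
    · have hw : w ε s C₁ C₂ = fun r => -1 / (s * (Real.log r + C₂) ^ 2) := by
        funext r; simp [w, hs.not_gt, hs.ne, hC]
      -- This is the limit of `-c cot (c (ρ + C₂))` as `c → 0`.
      refine ⟨fun ρ => -(ρ + C₂)⁻¹, fun ρ hρ => ?_⟩
      have hne : ρ + C₂ ≠ 0 := by
        have := hρ.2.2 hs hC
        rwa [Real.log_exp] at this
      have d := (hasDerivAt_id' ρ).add_const C₂
      have hs' := hs.ne
      simp only [hw, Real.log_exp]
      refine ⟨?_, ?_, ?_, ?_, ?_⟩
      · refine ((hasDerivAt_const ρ (-1)).fun_div ((d.fun_pow 2).const_mul s)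
          (mul_ne_zero hs.ne (pow_ne_zero 2 hne))).congr_deriv ?_
        simp
        field_simp
      · refine (d.fun_inv hne).neg.congr_deriv ?_
        field_simp
      · rw [hC]
        field_simp
        ring
      · have : 0 < (ρ + C₂) ^ 2 := by positivity
        exact div_pos_of_neg_of_neg (by norm_num) (mul_neg_of_neg_of_pos hs this)
      · exact contDiffAt_const.div (contDiffAt_const.mul ((hlog ρ).pow 2))
          (by rw [Real.log_exp]; exact mul_ne_zero hs.ne (pow_ne_zero 2 hne))

end Profile

/-! ### Invertible forms and splittings of the model space. -/

section LinearAlgebra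

open ContinuousLinearMap Filter Topology

variable {X Y : Type*} [NormedAddCommGroup X] [NormedSpace ℝ X]
  [NormedAddCommGroup Y] [NormedSpace ℝ Y]

theorem isInvertible_of_bijective [CompleteSpace X] [CompleteSpace Y] {f : X →L[ℝ] Y}
    (hf : Function.Bijective f) : f.IsInvertible :=
  ⟨ContinuousLinearEquiv.ofBijective f (LinearMap.ker_eq_bot.2 hf.1)
    (LinearMap.range_eq_top.2 hf.2), ContinuousLinearEquiv.coe_ofBijective _ _ _⟩

theorem bilinearComp_bijective {B : X →L[ℝ] X →L[ℝ] ℝ} (hB : Function.Bijective B)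
    {A : Y →L[ℝ] X} (hA : A.IsInvertible) : Function.Bijective (B.bilinearComp A A) := by
  constructor
  · intro u v huv
    apply hA.injective
    apply hB.1
    ext a
    obtain ⟨w, rfl⟩ := hA.surjective a
    exact congrArg (fun L : Y →L[ℝ] ℝ => L w) huv
  · intro φ
    obtain ⟨b, hb⟩ := hB.2 (φ.comp A.inverse)
    refine ⟨A.inverse b, ?_⟩
    ext w
    simp [bilinearComp_apply, hA.self_apply_inverse, hb, hA.inverse_apply_self]

theorem warped_bijective_right {F : Type*} [NormedAddCommGroup F] [NormedSpace ℝ F] {κ : ℝ}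
    {W : ℝ → ℝ} {h : F → F →L[ℝ] F →L[ℝ] ℝ} {q : ℝ × F}
    (hw : Function.Bijective (warped κ W h q)) : Function.Bijective (h q.2) := by
  constructor
  · rw [injective_iff_map_eq_zero]
    intro u hu
    have : ((0 : ℝ), u) = 0 := by
      apply (injective_iff_map_eq_zero _).1 hw.1
      ext <;> simp [warped_apply, hu]
    exact (Prod.mk_eq_zero.1 this).2
  · intro φ
    obtain ⟨a, ha⟩ := hw.2 (φ.comp (ContinuousLinearMap.snd ℝ ℝ F))
    -- The `F` block of the warped form is `W` times `h`, so the preimage of a functional under `h`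
    -- carries the factor `W`; no division by `W` occurs.
    refine ⟨W q.1 • a.2, ?_⟩
    ext v
    have := congrArg (fun L : (ℝ × F) →L[ℝ] ℝ => L (0, v)) ha
    simp only [warped_apply] at this
    simpa using this

theorem completeSpace_of_equiv_real_prod [CompleteSpace X] (e : X ≃L[ℝ] (ℝ × Y)) :
    CompleteSpace Y := by
  have h1 : CompleteSpace (ℝ × Y) := (completeSpace_congr (e := e.toEquiv) e.isUniformEmbedding).1 ‹_›
  have h2 : Isometry (fun y : Y => ((0 : ℝ), y)) := by
    intro a b
    simp [Prod.edist_eq]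
  rw [completeSpace_iff_isComplete_range h2.isUniformInducing]
  apply IsClosed.isComplete
  have : range (fun y : Y => ((0 : ℝ), y)) = Prod.fst ⁻¹' {0} := by
    ext ⟨a, b⟩
    simp [eq_comm]
  rw [this]
  exact isClosed_singleton.preimage continuous_fst

/-- Any nonzero functional is the first coordinate of an isomorphism with `ℝ × Y`, if there is such
an isomorphism at all. -/
theorem exists_equiv_fst_eq (e : X ≃L[ℝ] (ℝ × Y)) {φ : X →L[ℝ] ℝ} (hφ : φ ≠ 0) :
    ∃ L : X ≃L[ℝ] (ℝ × Y), ∀ a, (L a).1 = φ a := by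
  set φ₀ : X →L[ℝ] ℝ := (ContinuousLinearMap.fst ℝ ℝ Y).comp (e : X →L[ℝ] ℝ × Y) with hφ₀
  -- The kernels of two nonzero functionals do not cover the space: if each witness lies in the
  -- other kernel, their sum lies in neither.
  obtain ⟨b, hb, hb₀⟩ : ∃ b, φ b ≠ 0 ∧ φ₀ b ≠ 0 := by
    obtain ⟨b₁, h₁⟩ : ∃ b, φ b ≠ 0 := by
      by_contra! h; exact hφ (ContinuousLinearMap.ext h)
    have h₂ : φ₀ (e.symm (1, 0)) ≠ 0 := by simp [hφ₀]
    by_cases h₃ : φ₀ b₁ = 0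
    · by_cases h₄ : φ (e.symm (1, 0)) = 0
      · exact ⟨b₁ + e.symm (1, 0), by simpa [h₄] using h₁, by simpa [h₃] using h₂⟩
      · exact ⟨_, h₄, h₂⟩
    · exact ⟨b₁, h₁, h₃⟩
  -- A shear along `b` with `φ₀ ∘ T = φ`; exchanging `φ` and `φ₀` gives its inverse.
  let T : X ≃L[ℝ] X := ContinuousLinearEquiv.equivOfInverse
    (ContinuousLinearMap.id ℝ X + ((φ₀ b)⁻¹ • (φ - φ₀)).smulRight b)
    (ContinuousLinearMap.id ℝ X + ((φ b)⁻¹ • (φ₀ - φ)).smulRight b)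
    (by
      intro a
      simp only [add_apply, sub_apply, smul_apply, smulRight_apply, ContinuousLinearMap.id_apply,
        map_add, map_smul, smul_eq_mul]
      match_scalars
      · ring
      · field_simp
        ring)
    (by
      intro a
      simp only [add_apply, sub_apply, smul_apply, smulRight_apply, ContinuousLinearMap.id_apply,
        map_add, map_smul, smul_eq_mul]
      match_scalars
      · ring
      · field_simp
        ring)
  refine ⟨T.trans e, fun a => ?_⟩
  change φ₀ (a + ((φ₀ b)⁻¹ * (φ a - φ₀ a)) • b) = φ a
  rw [map_add, map_smul, smul_eq_mul]
  field_simp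
  ring

end LinearAlgebra

/-! ### Pullbacks of metrics in charts. -/

section Charts

open ContinuousLinearMap Filter Topology

variable {E : Type*} [NormedAddCommGroup E] [NormedSpace ℝ E]
  {M : Type*} [TopologicalSpace M] [ChartedSpace E M]
  {F : Type*} [NormedAddCommGroup F] [NormedSpace ℝ F]

/-- A field of bilinear forms with the tangent spaces identified with the model space. -/
def modelForm (B : BilinField E M) (x : M) : E →L[ℝ] E →L[ℝ] ℝ := B x

theorem pullback_apply (B : BilinField E M) (σ : F → M) (p u v : F) :
    pullback B σ p u v = modelForm B (σ p) (mfderiv 𝓘(ℝ, F) 𝓘(ℝ, E) σ p u)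
      (mfderiv 𝓘(ℝ, F) 𝓘(ℝ, E) σ p v) := rfl

variable [IsManifold 𝓘(ℝ, E) ∞ M]

theorem mdifferentiableAt_chart {x y : M} (hy : y ∈ (extChartAt 𝓘(ℝ, E) x).source) :
    MDifferentiableAt 𝓘(ℝ, E) 𝓘(ℝ, E) (extChartAt 𝓘(ℝ, E) x) y :=
  (contMDiffAt_extChartAt' (n := ∞) (by simpa using hy)).mdifferentiableAt (by simp)

theorem contMDiffAt_chart_symm {x : M} {e : E} (he : e ∈ (extChartAt 𝓘(ℝ, E) x).target) :
    ContMDiffAt 𝓘(ℝ, E) 𝓘(ℝ, E) ∞ (extChartAt 𝓘(ℝ, E) x).symm e :=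
  (contMDiffOn_extChartAt_symm x).contMDiffAt ((isOpen_extChartAt_target x).mem_nhds he)

theorem mfderiv_chart_symm_comp {x : M} {σ : F → M} {q : F}
    (hσ : MDifferentiableAt 𝓘(ℝ, F) 𝓘(ℝ, E) σ q) (hq : σ q ∈ (extChartAt 𝓘(ℝ, E) x).source)
    (u : F) :
    (mfderiv 𝓘(ℝ, F) 𝓘(ℝ, E) σ q u : E) =
      mfderiv 𝓘(ℝ, E) 𝓘(ℝ, E) (extChartAt 𝓘(ℝ, E) x).symm (extChartAt 𝓘(ℝ, E) x (σ q))
        (fderiv ℝ (extChartAt 𝓘(ℝ, E) x ∘ σ) q u) := by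
  have h1 := (mdifferentiableAt_chart hq).hasMFDerivAt.comp q hσ.hasMFDerivAt
  have h2 : MDifferentiableAt 𝓘(ℝ, E) 𝓘(ℝ, E) (extChartAt 𝓘(ℝ, E) x).symm
      (extChartAt 𝓘(ℝ, E) x (σ q)) :=
    (contMDiffAt_chart_symm ((extChartAt 𝓘(ℝ, E) x).map_source hq)).mdifferentiableAt (by simp)
  have h3 : HasMFDerivAt 𝓘(ℝ, F) 𝓘(ℝ, E)
      ((extChartAt 𝓘(ℝ, E) x).symm ∘ (extChartAt 𝓘(ℝ, E) x ∘ σ)) q _ :=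
    h2.hasMFDerivAt.comp q h1
  have h4 : σ =ᶠ[𝓝 q] (extChartAt 𝓘(ℝ, E) x).symm ∘ (extChartAt 𝓘(ℝ, E) x ∘ σ) := by
    filter_upwards [hσ.continuousAt ((isOpen_extChartAt_source x).mem_nhds hq)] with r hr
    exact ((extChartAt 𝓘(ℝ, E) x).left_inv hr).symm
  have h5 := (h3.congr_of_eventuallyEq h4).mfderiv
  have h6 := h1.mfderiv
  rw [mfderiv_eq_fderiv] at h6
  rw [h6]
  exact congrArg (fun L : F →L[ℝ] E => L u) h5

/-- With `ψ` the chart composed with `σ`, this is the relation `heq` that the naturality lemmas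
require. -/
theorem pullback_eq_bilinearComp (B : BilinField E M) {x : M} {σ : F → M} {q : F}
    (hσ : MDifferentiableAt 𝓘(ℝ, F) 𝓘(ℝ, E) σ q) (hq : σ q ∈ (extChartAt 𝓘(ℝ, E) x).source) :
    pullback B σ q =
      (pullback B (extChartAt 𝓘(ℝ, E) x).symm (extChartAt 𝓘(ℝ, E) x (σ q))).bilinearComp
        (fderiv ℝ (extChartAt 𝓘(ℝ, E) x ∘ σ) q) (fderiv ℝ (extChartAt 𝓘(ℝ, E) x ∘ σ) q) := by
  ext u v
  rw [pullback_apply, bilinearComp_apply, pullback_apply, (extChartAt 𝓘(ℝ, E) x).left_inv hq]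
  erw [mfderiv_chart_symm_comp hσ hq u, mfderiv_chart_symm_comp hσ hq v]
  rfl

theorem contDiffAt_chart_comp {x : M} {σ : F → M} {q : F}
    (hσ : ContMDiffAt 𝓘(ℝ, F) 𝓘(ℝ, E) ∞ σ q) (hq : σ q ∈ (extChartAt 𝓘(ℝ, E) x).source) :
    ContDiffAt ℝ ∞ (extChartAt 𝓘(ℝ, E) x ∘ σ) q := by
  rw [← contMDiffAt_iff_contDiffAt]
  exact (contMDiffAt_extChartAt' (n := ∞) (by simpa using hq)).comp q hσ

/-- Smoothness of the section `g` is smoothness in the trivialization at `x`. The inverse of the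
tangent trivialization is the differential of the inverse chart, so this local expression is the
pullback. -/
theorem contDiffAt_pullback_chart (g : PseudoRiemannianMetric E M) (x : M) {e : E}
    (he : e ∈ (extChartAt 𝓘(ℝ, E) x).target) :
    ContDiffAt ℝ ∞ (pullback g.val (extChartAt 𝓘(ℝ, E) x).symm) e := by
  have h1 := ((trivializationAt (E →L[ℝ] E →L[ℝ] ℝ) (fun y : M =>
    TangentSpace 𝓘(ℝ, E) y →L[ℝ] TangentSpace 𝓘(ℝ, E) y →L[ℝ] ℝ) x).contMDiffOn_section_baseSet_iff
      (IB := 𝓘(ℝ, E)) (n := ∞) (s := g.val)).1 g.contMDiff.contMDiffOn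
  have h2 := h1.comp (contMDiffOn_extChartAt_symm (n := ∞) (I := 𝓘(ℝ, E)) x) (by
    intro e he
    have := (extChartAt 𝓘(ℝ, E) x).map_target he
    simpa using this)
  rw [contMDiffOn_iff_contDiffOn] at h2
  refine (h2.contDiffAt ((isOpen_extChartAt_target x).mem_nhds he)).congr_of_eventuallyEq ?_
  filter_upwards [(isOpen_extChartAt_target x).mem_nhds he] with e he
  have hs := (extChartAt 𝓘(ℝ, E) x).map_target he
  have hs' : (extChartAt 𝓘(ℝ, E) x).symm e ∈ (chartAt E x).source := by simpa using hs
  have hL := TangentBundle.symmL_trivializationAt (𝕜 := ℝ) (I := 𝓘(ℝ, E)) hs'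
  rw [(extChartAt 𝓘(ℝ, E) x).right_inv he] at hL
  rw [ModelWithCorners.range_eq_univ, mfderivWithin_univ] at hL
  ext u v
  have hu := fun u : E => (Bundle.Trivialization.symmL_apply (R := ℝ)
    (trivializationAt E (TangentSpace 𝓘(ℝ, E)) x) (by simpa using hs) u).symm.trans
      (congrArg (fun L : E →L[ℝ] E => L u) hL)
  refine Eq.trans ?_ (inCoordinates_apply_eq₂ (F₁ := E) (F₂ := E) (F₃ := ℝ)
    (E₁ := TangentSpace 𝓘(ℝ, E)) (E₂ := TangentSpace 𝓘(ℝ, E)) (E₃ := fun _ : M => ℝ)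
    (x₀ := x) (ϕ := g.val ((extChartAt 𝓘(ℝ, E) x).symm e)) (v := u) (w := v)
    (by simpa using hs) (by simpa using hs) (by simp)).symm
  rw [pullback_apply]
  erw [← hu u, ← hu v]
  simp
  rfl

theorem contDiffAt_pullback (g : PseudoRiemannianMetric E M) {σ : F → M} {q : F}
    (hσ : ∀ᶠ p in 𝓝 q, ContMDiffAt 𝓘(ℝ, F) 𝓘(ℝ, E) ∞ σ p) :
    ContDiffAt ℝ ∞ (pullback g.val σ) q := by
  have hq := mem_extChartAt_source (I := 𝓘(ℝ, E)) (σ q)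
  have h1 := contDiffAt_chart_comp hσ.self_of_nhds hq
  have h2 := (contDiffAt_pullback_chart g (σ q) (mem_extChartAt_target (σ q))).comp q h1
  refine (bilinearComp_contDiffAt h2 (h1.fderiv_right (m := ∞) (by simp))).congr_of_eventuallyEq ?_
  filter_upwards [hσ, hσ.self_of_nhds.continuousAt
    ((isOpen_extChartAt_source (I := 𝓘(ℝ, E)) (σ q)).mem_nhds hq)] with r hr hr2
  exact pullback_eq_bilinearComp g.val (hr.mdifferentiableAt (by simp)) hr2

end Charts

/-! ### Local parametrizations of regular level sets. -/

section LevelSets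

open ContinuousLinearMap Filter Topology

variable {E : Type*} [NormedAddCommGroup E] [NormedSpace ℝ E]
  {M : Type*} [TopologicalSpace M] [ChartedSpace E M] [IsManifold 𝓘(ℝ, E) ∞ M]
  {F : Type*} [NormedAddCommGroup F] [NormedSpace ℝ F]

theorem isInvertible_mfderiv_chart_symm {x : M} {e : E} (he : e ∈ (extChartAt 𝓘(ℝ, E) x).target) :
    ContinuousLinearMap.IsInvertible
      (mfderiv 𝓘(ℝ, E) 𝓘(ℝ, E) (extChartAt 𝓘(ℝ, E) x).symm e : E →L[ℝ] E) := by
  have := isInvertible_mfderivWithin_extChartAt_symm he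
  rwa [ModelWithCorners.range_eq_univ, mfderivWithin_univ] at this

/-- Local parametrizations, in a normed space, of the level sets of a submersion to `ℝ`. -/
theorem exists_level_parametrization_of_equiv [CompleteSpace E] (L : E ≃L[ℝ] (ℝ × F)) {φ : E → ℝ} {V : Set E}
    (hV : IsOpen V) (hφ : ContDiffOn ℝ ∞ φ V) {e₀ : E} (he₀ : e₀ ∈ V)
    (hL : ∀ a, (L a).1 = fderiv ℝ φ e₀ a) :
    ∃ (U : Set F) (s : F → E) (p₀ : F), IsOpen U ∧ p₀ ∈ U ∧ s p₀ = e₀ ∧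
      ∀ p ∈ U, s p ∈ V ∧ ContDiffAt ℝ ∞ s p ∧ φ (s p) = φ e₀ ∧
        Function.Injective (fderiv ℝ s p) ∧
        ∀ a, (∃ u, fderiv ℝ s p u = a) ↔ fderiv ℝ φ (s p) a = 0 := by
  set pr : E →L[ℝ] F := (ContinuousLinearMap.snd ℝ ℝ F).comp (L : E →L[ℝ] ℝ × F) with hpr
  -- `H` straightens `φ` to the first coordinate: by `hL` its derivative at `e₀` is `L`, so the
  -- inverse function theorem applies, and slices `(φ e₀, ·)` of the local inverse parametrize the
  -- level set.
  set H : E → ℝ × F := fun e => (φ e, pr e) with hH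
  have hφa : ∀ e ∈ V, ContDiffAt ℝ ∞ φ e := fun e he => hφ.contDiffAt (hV.mem_nhds he)
  have hHs : ∀ e ∈ V, ContDiffAt ℝ ∞ H e := fun e he => (hφa e he).prodMk pr.contDiff.contDiffAt
  have hHd : ∀ e ∈ V, fderiv ℝ H e = (fderiv ℝ φ e).prod pr := fun e he =>
    (((hφa e he).differentiableAt (by simp)).hasFDerivAt.prodMk pr.hasFDerivAt).fderiv
  have hH0 : HasFDerivAt H (L : E →L[ℝ] ℝ × F) e₀ := by
    have h := ((hHs e₀ he₀).differentiableAt (by simp)).hasFDerivAt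
    rw [hHd e₀ he₀] at h
    refine h.congr_fderiv (ContinuousLinearMap.ext fun a => ?_)
    exact Prod.ext (hL a).symm rfl
  set R := (hHs e₀ he₀).toOpenPartialHomeomorph H hH0 (by simp) with hR
  -- Smoothness of the local inverse at a point needs an invertible derivative of `H` there;
  -- invertibility is an open condition, so the domain is shrunk to this open set.
  set V' := V ∩ fderiv ℝ H ⁻¹' range ((↑) : (E ≃L[ℝ] (ℝ × F)) → E →L[ℝ] ℝ × F) with hV'
  have hV'o : IsOpen V' := by
    refine ContinuousOn.isOpen_inter_preimage ?_ hV ContinuousLinearEquiv.isOpen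
    intro e he
    exact ((hHs e he).fderiv_right (m := 0) (by simp)).continuousAt.continuousWithinAt
  have hp0 : R.symm (φ e₀, pr e₀) = e₀ :=
    R.left_inv ((hHs e₀ he₀).mem_toOpenPartialHomeomorph_source hH0 (by simp))
  have ht0 : (φ e₀, pr e₀) ∈ R.target :=
    R.map_source ((hHs e₀ he₀).mem_toOpenPartialHomeomorph_source hH0 (by simp))
  have hcont : Continuous fun p : F => (φ e₀, p) := by fun_prop
  refine ⟨(fun p => (φ e₀, p)) ⁻¹' (R.target ∩ R.symm ⁻¹' V'), fun p => R.symm (φ e₀, p), pr e₀,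
    (R.symm.isOpen_inter_preimage hV'o).preimage hcont, ⟨ht0, ?_⟩, hp0, ?_⟩
  · rw [mem_preimage, hp0]
    exact ⟨he₀, L, hH0.fderiv.symm⟩
  · rintro p ⟨hpt, hpV, A, hA⟩
    have hRH : ∀ q ∈ R.target, H (R.symm q) = q := fun q hq => R.right_inv hq
    have hA' : HasFDerivAt H (A : E →L[ℝ] ℝ × F) (R.symm (φ e₀, p)) := by
      rw [hA]; exact ((hHs _ hpV).differentiableAt (by simp)).hasFDerivAt
    have hsR : ContDiffAt ℝ ∞ R.symm (φ e₀, p) := R.contDiffAt_symm hpt hA' (hHs _ hpV)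
    have hs : ContDiffAt ℝ ∞ (fun p => R.symm (φ e₀, p)) p :=
      hsR.comp p (contDiffAt_const.prodMk contDiffAt_id)
    have hsd := hs.differentiableAt (by simp)
    have hev : (fun p => H (R.symm (φ e₀, p))) =ᶠ[𝓝 p] fun p => (φ e₀, p) := by
      filter_upwards [hcont.continuousAt (R.open_target.mem_nhds hpt)] with r hr using hRH _ hr
    have hcomp : ∀ u, A (fderiv ℝ (fun p => R.symm (φ e₀, p)) p u) = (0, u) := by
      intro u
      have h1 := (hA'.comp p hsd.hasFDerivAt).congr_of_eventuallyEq hev.symm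
      have h2 : HasFDerivAt (fun p : F => (φ e₀, p)) (ContinuousLinearMap.inr ℝ ℝ F) p :=
        (hasFDerivAt_const (φ e₀) p).prodMk (hasFDerivAt_id p)
      exact congrArg (fun T : F →L[ℝ] ℝ × F => T u) (h1.unique h2)
    have hAf : ∀ a, A a = (fderiv ℝ φ (R.symm (φ e₀, p)) a, pr a) := by
      intro a
      have := congrArg (fun T : E →L[ℝ] ℝ × F => T a) (hA.trans (hHd _ hpV))
      exact this
    refine ⟨hpV, hs, congrArg Prod.fst (hRH _ hpt), ?_, fun a => ⟨?_, fun ha => ⟨pr a, ?_⟩⟩⟩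
    · intro u v huv
      have := congrArg A huv
      rw [hcomp, hcomp] at this
      exact congrArg Prod.snd this
    · rintro ⟨u, rfl⟩
      have := hcomp u
      rw [hAf] at this
      exact congrArg Prod.fst this
    · apply A.injective
      rw [hcomp, hAf, ha]

/-- In the chart at `y` the differential of `f` is nonzero, hence is the first coordinate of a
suitable splitting of `E`. The parametrization in `E` is carried to `M` by the inverse chart, whose
differentials are invertible. -/
theorem exists_isLevelParametrization [CompleteSpace E] (hE : E ≃L[ℝ] (ℝ × F)) {f : M → ℝ}
    (hf : ContMDiff 𝓘(ℝ, E) 𝓘(ℝ, ℝ) ∞ f) {y : M} {b : E}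
    (hb : (mfderiv 𝓘(ℝ, E) 𝓘(ℝ, ℝ) f y : E →L[ℝ] ℝ) b ≠ 0) :
    ∃ (U : Set F) (σ : F → M) (p₀ : F), p₀ ∈ U ∧ σ p₀ = y ∧
      IsLevelParametrization (E := E) f (f y) U σ := by
  set χ := extChartAt 𝓘(ℝ, E) y with hχ
  have hmd : ∀ e ∈ χ.target, ∀ a : E, fderiv ℝ (f ∘ χ.symm) e a =
      (mfderiv 𝓘(ℝ, E) 𝓘(ℝ, ℝ) f (χ.symm e) : E →L[ℝ] ℝ)
        ((mfderiv 𝓘(ℝ, E) 𝓘(ℝ, E) χ.symm e : E →L[ℝ] E) a) := by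
    intro e he a
    rw [← mfderiv_eq_fderiv, mfderiv_comp e (hf.contMDiffAt.mdifferentiableAt (by simp))
      ((contMDiffAt_chart_symm he).mdifferentiableAt (by simp))]
    rfl
  have hy : χ y ∈ χ.target := mem_extChartAt_target y
  have hyy : χ.symm (χ y) = y := extChartAt_to_inv y
  have hfs : ContDiffOn ℝ ∞ (f ∘ χ.symm) χ.target := by
    rw [← contMDiffOn_iff_contDiffOn]
    exact hf.comp_contMDiffOn (contMDiffOn_extChartAt_symm y)
  have hne : fderiv ℝ (f ∘ χ.symm) (χ y) ≠ 0 := by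
    obtain ⟨a, ha⟩ := (isInvertible_mfderiv_chart_symm hy).surjective b
    intro h0
    apply hb
    have h1 := hmd (χ y) hy a
    rw [h0] at h1
    rw [← ha]
    rw [hyy] at h1
    exact h1.symm
  obtain ⟨L, hL⟩ := exists_equiv_fst_eq hE hne
  obtain ⟨U, s, p₀, hU, hp₀, hs0, hs⟩ :=
    exists_level_parametrization_of_equiv L (isOpen_extChartAt_target y) hfs hy hL
  refine ⟨U, χ.symm ∘ s, p₀, hp₀, by simp [hs0, hyy], ?_⟩
  have hσd : ∀ p ∈ U, ∀ u, (mfderiv 𝓘(ℝ, F) 𝓘(ℝ, E) (χ.symm ∘ s) p : F →L[ℝ] E) u =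
      (mfderiv 𝓘(ℝ, E) 𝓘(ℝ, E) χ.symm (s p) : E →L[ℝ] E) (fderiv ℝ s p u) := by
    intro p hp u
    obtain ⟨h1, h2, -⟩ := hs p hp
    rw [mfderiv_comp p ((contMDiffAt_chart_symm h1).mdifferentiableAt (by simp))
      (h2.contMDiffAt.mdifferentiableAt (by simp)), mfderiv_eq_fderiv]
    rfl
  refine ⟨hU, ?_, ?_, ?_, ?_⟩
  · intro p hp
    obtain ⟨h1, h2, -⟩ := hs p hp
    exact ((contMDiffAt_chart_symm h1).comp p h2.contMDiffAt).contMDiffWithinAt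
  · intro p hp
    obtain ⟨-, -, h3, -⟩ := hs p hp
    simpa [hyy] using h3
  · intro p hp
    obtain ⟨h1, -, -, h4, -⟩ := hs p hp
    intro u v huv
    apply h4
    apply (isInvertible_mfderiv_chart_symm h1).injective
    erw [← hσd p hp u, ← hσd p hp v]
    exact huv
  · intro p hp a
    obtain ⟨h1, -, -, -, h5⟩ := hs p hp
    obtain ⟨a', rfl⟩ := (isInvertible_mfderiv_chart_symm h1).surjective a
    refine Iff.trans ?_ ((h5 a').trans (Eq.congr_left (hmd _ h1 a')))
    constructor
    · rintro ⟨u, hu⟩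
      exact ⟨u, (isInvertible_mfderiv_chart_symm h1).injective ((hσd p hp u).symm.trans hu)⟩
    · rintro ⟨u, rfl⟩
      exact ⟨u, hσd p hp u⟩

end LevelSets

/-! ### Differentials of the action and of the flow map. -/

section Action

open ContinuousLinearMap Filter Topology

variable {E : Type*} [NormedAddCommGroup E] [NormedSpace ℝ E]
  {M : Type*} [TopologicalSpace M] [ChartedSpace E M]
  {F : Type*} [NormedAddCommGroup F] [NormedSpace ℝ F]

/-- The differential of a map between manifolds, with the tangent spaces identified with the model
spaces. -/
def modelDeriv {E₁ E₂ M₁ M₂ : Type*} [NormedAddCommGroup E₁] [NormedSpace ℝ E₁]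
    [NormedAddCommGroup E₂] [NormedSpace ℝ E₂] [TopologicalSpace M₁] [ChartedSpace E₁ M₁]
    [TopologicalSpace M₂] [ChartedSpace E₂ M₂] (φ : M₁ → M₂) (x : M₁) : E₁ →L[ℝ] E₂ :=
  mfderiv 𝓘(ℝ, E₁) 𝓘(ℝ, E₂) φ x

/-- The generator of an action, with the tangent spaces identified with the model space. -/
def modelGenerator (E : Type*) [NormedAddCommGroup E] [NormedSpace ℝ E]
    {M : Type*} [TopologicalSpace M] [ChartedSpace E M] (m : ℝ → M → M) (x : M) : E :=
  generator E m x

theorem modelDeriv_comp {E₁ E₂ E₃ M₁ M₂ M₃ : Type*} [NormedAddCommGroup E₁] [NormedSpace ℝ E₁]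
    [NormedAddCommGroup E₂] [NormedSpace ℝ E₂] [NormedAddCommGroup E₃] [NormedSpace ℝ E₃]
    [TopologicalSpace M₁] [ChartedSpace E₁ M₁]
    [TopologicalSpace M₂] [ChartedSpace E₂ M₂] [TopologicalSpace M₃] [ChartedSpace E₃ M₃]
    {φ : M₁ → M₂} {χ : M₂ → M₃} {x : M₁} (hχ : MDifferentiableAt 𝓘(ℝ, E₂) 𝓘(ℝ, E₃) χ (φ x))
    (hφ : MDifferentiableAt 𝓘(ℝ, E₁) 𝓘(ℝ, E₂) φ x) (u : E₁) :
    (modelDeriv (χ ∘ φ) x : E₁ →L[ℝ] E₃) u =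
      (modelDeriv χ (φ x) : E₂ →L[ℝ] E₃) ((modelDeriv φ x : E₁ →L[ℝ] E₂) u) := by
  exact congrArg (fun L : E₁ →L[ℝ] E₃ => L u) (mfderiv_comp x hχ hφ)

theorem modelDeriv_eq_fderiv {E₁ E₂ : Type*} [NormedAddCommGroup E₁] [NormedSpace ℝ E₁]
    [NormedAddCommGroup E₂] [NormedSpace ℝ E₂] (φ : E₁ → E₂) (x : E₁) :
    modelDeriv φ x = fderiv ℝ φ x := mfderiv_eq_fderiv

variable {m : ℝ → M → M} (hm : IsFreePosAction E m)
include hm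

theorem IsFreePosAction.contMDiffAt_comp {X N : Type*} [NormedAddCommGroup X] [NormedSpace ℝ X]
    [TopologicalSpace N] [ChartedSpace X N]
    {c : N → ℝ} {σ : N → M} {q : N} (hc : ContMDiffAt 𝓘(ℝ, X) 𝓘(ℝ, ℝ) ∞ c q)
    (hσ : ContMDiffAt 𝓘(ℝ, X) 𝓘(ℝ, E) ∞ σ q) (h0 : 0 < c q) :
    ContMDiffAt 𝓘(ℝ, X) 𝓘(ℝ, E) ∞ (fun p => m (c p) (σ p)) q := by
  have h1 : ContMDiffAt (𝓘(ℝ, ℝ).prod 𝓘(ℝ, E)) 𝓘(ℝ, E) ∞ (fun q : ℝ × M => m q.1 q.2)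
      (c q, σ q) :=
    hm.contMDiffOn.contMDiffAt ((isOpen_Ioi.prod isOpen_univ).mem_nhds ⟨h0, mem_univ _⟩)
  exact h1.comp q (hc.prodMk hσ)

theorem IsFreePosAction.contMDiff_act {t : ℝ} (ht : 0 < t) :
    ContMDiff 𝓘(ℝ, E) 𝓘(ℝ, E) ∞ (m t) := fun _ =>
  hm.contMDiffAt_comp contMDiffAt_const contMDiffAt_id ht

theorem IsFreePosAction.inv_act {t : ℝ} (ht : 0 < t) (x : M) : m t (m t⁻¹ x) = x := by
  rw [← hm.mul t t⁻¹ ht (inv_pos.2 ht), mul_inv_cancel₀ ht.ne', hm.one]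

theorem IsFreePosAction.surjective_modelDeriv {t : ℝ} (ht : 0 < t) (x : M) (a : E) :
    ∃ b : E, (modelDeriv (m t) x : E →L[ℝ] E) b = a := by
  have hx : m t⁻¹ (m t x) = x := by
    have := hm.inv_act (inv_pos.2 ht) x
    rwa [inv_inv] at this
  refine ⟨(modelDeriv (m t⁻¹) (m t x) : E →L[ℝ] E) a, ?_⟩
  have h1 := modelDeriv_comp (χ := m t) (φ := m t⁻¹) (x := m t x)
    ((hm.contMDiff_act ht).contMDiffAt.mdifferentiableAt (by simp))
    ((hm.contMDiff_act (inv_pos.2 ht)).contMDiffAt.mdifferentiableAt (by simp)) a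
  have h2 : m t ∘ m t⁻¹ = id := funext fun y => hm.inv_act ht y
  rw [h2, hx] at h1
  rw [← h1]
  exact congrArg (fun L : E →L[ℝ] E => L a) (mfderiv_id (I := 𝓘(ℝ, E)) (x := m t x))

theorem IsFreePosAction.contMDiffAt_flow (z : M) (τ : ℝ) :
    ContMDiffAt 𝓘(ℝ, ℝ) 𝓘(ℝ, E) ∞ (fun s : ℝ => m (Real.exp s) z) τ :=
  hm.contMDiffAt_comp Real.contDiff_exp.contMDiff.contMDiffAt contMDiffAt_const (Real.exp_pos τ)

/-- By the one-parameter group law, the orbit of `z` near time `τ` is the orbit of `m (e^τ) z` near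
time `0`, with time shifted. -/
theorem IsFreePosAction.modelDeriv_flow (z : M) (τ a : ℝ) :
    (modelDeriv (fun s : ℝ => m (Real.exp s) z) τ : ℝ →L[ℝ] E) a =
      a • (modelGenerator E m (m (Real.exp τ) z)) := by
  have h1 : (fun s : ℝ => m (Real.exp s) z) =
      (fun s : ℝ => m (Real.exp s) (m (Real.exp τ) z)) ∘ fun s => s - τ := by
    funext s
    rw [Function.comp_apply, ← hm.mul _ _ (Real.exp_pos _) (Real.exp_pos _), ← Real.exp_add,
      sub_add_cancel]
  have h2 := modelDeriv_comp (φ := fun s : ℝ => s - τ)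
    (χ := fun s : ℝ => m (Real.exp s) (m (Real.exp τ) z)) (x := τ)
    ((hm.contMDiffAt_flow _ _).mdifferentiableAt (by simp))
    (by
      rw [mdifferentiableAt_iff_differentiableAt]
      fun_prop) a
  rw [h1, h2, modelDeriv_eq_fderiv, fderiv_sub_const, sub_self]
  rw [fderiv_fun_id, ContinuousLinearMap.id_apply]
  have : a = a • (1 : ℝ) := by simp
  rw [this, map_smul]
  simp
  rfl

/-- The map `(τ, p) ↦ m (e^τ) (σ p)`. -/
theorem IsFreePosAction.contMDiffAt_flowMap {σ : F → M} {q : ℝ × F}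
    (hσ : ContMDiffAt 𝓘(ℝ, F) 𝓘(ℝ, E) ∞ σ q.2) :
    ContMDiffAt 𝓘(ℝ, ℝ × F) 𝓘(ℝ, E) ∞ (fun q : ℝ × F => m (Real.exp q.1) (σ q.2)) q :=
  hm.contMDiffAt_comp (Real.contDiff_exp.comp contDiff_fst).contMDiff.contMDiffAt
    (hσ.comp (I' := 𝓘(ℝ, F)) q contDiff_snd.contMDiff.contMDiffAt) (Real.exp_pos _)

theorem IsFreePosAction.modelDeriv_flowMap {σ : F → M} {q : ℝ × F}
    (hσ : ContMDiffAt 𝓘(ℝ, F) 𝓘(ℝ, E) ∞ σ q.2) (U : ℝ × F) :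
    (modelDeriv (fun q : ℝ × F => m (Real.exp q.1) (σ q.2)) q : ℝ × F →L[ℝ] E) U =
      U.1 • (modelGenerator E m (m (Real.exp q.1) (σ q.2))) +
        (modelDeriv (m (Real.exp q.1)) (σ q.2) : E →L[ℝ] E)
          ((modelDeriv σ q.2 : F →L[ℝ] E) U.2) := by
  have hΦ := (hm.contMDiffAt_flowMap hσ).mdifferentiableAt (by simp)
  have e1 : HasFDerivAt (fun s : ℝ => (s, q.2)) (ContinuousLinearMap.inl ℝ ℝ F) q.1 :=
    (hasFDerivAt_id q.1).prodMk (hasFDerivAt_const q.2 q.1)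
  have e2 : HasFDerivAt (fun p : F => (q.1, p)) (ContinuousLinearMap.inr ℝ ℝ F) q.2 :=
    (hasFDerivAt_const q.1 q.2).prodMk (hasFDerivAt_id q.2)
  have h1 := modelDeriv_comp (φ := fun s : ℝ => (s, q.2)) (x := q.1) hΦ
    e1.differentiableAt.mdifferentiableAt U.1
  have h2 := modelDeriv_comp (φ := fun p : F => (q.1, p)) (x := q.2) hΦ
    e2.differentiableAt.mdifferentiableAt U.2
  have h3 := hm.modelDeriv_flow (σ q.2) q.1 U.1
  have h4 := modelDeriv_comp (φ := σ) (χ := m (Real.exp q.1)) (x := q.2)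
    ((hm.contMDiff_act (Real.exp_pos _)).contMDiffAt.mdifferentiableAt (by simp))
    (hσ.mdifferentiableAt (by simp)) U.2
  rw [modelDeriv_eq_fderiv, e1.fderiv] at h1
  rw [modelDeriv_eq_fderiv, e2.fderiv] at h2
  have hU : U = ContinuousLinearMap.inl ℝ ℝ F U.1 + ContinuousLinearMap.inr ℝ ℝ F U.2 := by
    simp
  refine (congrArg _ hU).trans ((map_add _ _ _).trans
    (congrArg₂ (· + ·) (h1.symm.trans ?_) (h2.symm.trans ?_)))
  · exact h3
  · exact h4

end Action

/-! ### Homogeneous pairs in flow coordinates. -/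

section Pairs

open ContinuousLinearMap Filter Topology

variable {E : Type*} [NormedAddCommGroup E] [NormedSpace ℝ E]
  {M : Type*} [TopologicalSpace M] [ChartedSpace E M] [IsManifold 𝓘(ℝ, E) ∞ M]
  {F : Type*} [NormedAddCommGroup F] [NormedSpace ℝ F]
  {m : ℝ → M → M} {g : PseudoRiemannianMetric E M} {f : M → ℝ} {α : ℝ}

theorem modelForm_symm (g : PseudoRiemannianMetric E M) (z : M) (a b : E) :
    modelForm g.val z a b = modelForm g.val z b a :=
  g.symm z a b

namespace IsHomogeneousPair

variable (h : IsHomogeneousPair m g f α)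
include h

/-- Euler's identity: differentiate `f (m (e^s) z) = e^{sα} f z` at `s = 0`. -/
theorem modelDeriv_generator (z : M) :
    (modelDeriv f z : E →L[ℝ] ℝ) (modelGenerator E m z) = α * f z := by
  have h1 := modelDeriv_comp (φ := fun s : ℝ => m (Real.exp s) z) (χ := f) (x := 0)
    (h.contMDiff.contMDiffAt.mdifferentiableAt (by simp))
    ((h.action.contMDiffAt_flow z 0).mdifferentiableAt (by simp)) (1 : ℝ)
  rw [h.action.modelDeriv_flow] at h1
  have h2 : (f ∘ fun s : ℝ => m (Real.exp s) z) = fun s => Real.exp (s * α) * f z := by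
    funext s
    rw [Function.comp_apply, h.homog_fun _ (Real.exp_pos _), ← Real.exp_mul]
  rw [h2, modelDeriv_eq_fderiv] at h1
  have h3 : HasDerivAt (fun s => Real.exp (s * α) * f z) (α * f z) 0 := by
    simpa using (((hasDerivAt_id (0 : ℝ)).mul_const α).exp).mul_const (f z)
  rw [h3.hasFDerivAt.fderiv] at h1
  have h4 : m (Real.exp 0) z = z := by rw [Real.exp_zero, h.action.one]
  rw [h4] at h1
  simpa using h1.symm

theorem modelForm_generator (z : M) (a : E) :
    modelForm g.val z (modelGenerator E m z) a = (modelDeriv f z : E →L[ℝ] ℝ) a :=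
  h.metric_generator z a

theorem modelForm_act {t : ℝ} (ht : 0 < t) (y : M) (a b : E) :
    modelForm g.val (m t y) ((modelDeriv (m t) y : E →L[ℝ] E) a)
      ((modelDeriv (m t) y : E →L[ℝ] E) b) = t ^ α * modelForm g.val y a b :=
  h.homog_metric t ht y a b

theorem modelDeriv_act {t : ℝ} (ht : 0 < t) (y : M) (a : E) :
    (modelDeriv f (m t y) : E →L[ℝ] ℝ) ((modelDeriv (m t) y : E →L[ℝ] E) a) =
      t ^ α * (modelDeriv f y : E →L[ℝ] ℝ) a := by
  have hfd : ∀ z, MDifferentiableAt 𝓘(ℝ, E) 𝓘(ℝ, ℝ) f z := fun z =>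
    h.contMDiff.contMDiffAt.mdifferentiableAt (by simp)
  have h1 := modelDeriv_comp (φ := m t) (χ := f) (x := y) (hfd _)
    ((h.action.contMDiff_act ht).contMDiffAt.mdifferentiableAt (by simp)) a
  have h2 : f ∘ m t = (fun r : ℝ => t ^ α * r) ∘ f := funext fun z => h.homog_fun t ht z
  have h3 := modelDeriv_comp (φ := f) (χ := fun r : ℝ => t ^ α * r) (x := y)
    (by rw [mdifferentiableAt_iff_differentiableAt]; fun_prop) (hfd y) a
  rw [← h1, h2, h3, modelDeriv_eq_fderiv]
  have h4 : HasDerivAt (fun r : ℝ => t ^ α * r) (t ^ α) (f y) := by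
    simpa using (hasDerivAt_id (f y)).const_mul (t ^ α)
  rw [h4.hasFDerivAt.fderiv]
  simp [mul_comm]

theorem f_flowMap {U : Set F} {σ : F → M} {l : ℝ}
    (hσ : IsLevelParametrization (E := E) f l U σ) {q : ℝ × F} (hq : q.2 ∈ U) :
    f (m (Real.exp q.1) (σ q.2)) = l * Real.exp (α * q.1) := by
  rw [h.homog_fun _ (Real.exp_pos _), hσ.mapsTo _ hq, ← Real.exp_mul, mul_comm, mul_comm q.1]

/-- The metric in the coordinates `(τ, p) ↦ m (e^τ) (σ p)`. -/
theorem pullback_flowMap {U : Set F} {σ : F → M} {l : ℝ}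
    (hσ : IsLevelParametrization (E := E) f l U σ) {q : ℝ × F} (hq : q.2 ∈ U) :
    pullback g.val (fun q : ℝ × F => m (Real.exp q.1) (σ q.2)) q =
      warped (α * l) (fun τ => Real.exp (α * τ)) (pullback g.val σ) q := by
  have hσc : ContMDiffAt 𝓘(ℝ, F) 𝓘(ℝ, E) ∞ σ q.2 :=
    hσ.contMDiffOn.contMDiffAt (hσ.isOpen.mem_nhds hq)
  have hD := h.action.modelDeriv_flowMap hσc
  set t := Real.exp q.1
  have ht : 0 < t := Real.exp_pos _
  have htα : t ^ α = Real.exp (α * q.1) := by rw [← Real.exp_mul, mul_comm]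
  have hker : ∀ u : F, (modelDeriv f (σ q.2) : E →L[ℝ] ℝ) ((modelDeriv σ q.2 : F →L[ℝ] E) u) = 0 :=
    fun u => (hσ.range_eq _ hq _).1 ⟨u, rfl⟩
  -- Pairing with the generator is `df`, which scales under `m t` and kills vectors tangent to the
  -- level set; hence the mixed part of the metric vanishes.
  have hgen : ∀ u : F, modelForm g.val (m t (σ q.2)) (modelGenerator E m (m t (σ q.2)))
      ((modelDeriv (m t) (σ q.2) : E →L[ℝ] E) ((modelDeriv σ q.2 : F →L[ℝ] E) u)) = 0 := by
    intro u
    rw [h.modelForm_generator, h.modelDeriv_act ht, hker, mul_zero]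
  have hPP : modelForm g.val (m t (σ q.2)) (modelGenerator E m (m t (σ q.2)))
      (modelGenerator E m (m t (σ q.2))) = Real.exp (α * q.1) * (α * l) := by
    rw [h.modelForm_generator, h.modelDeriv_generator, h.f_flowMap hσ hq]
    ring
  refine ContinuousLinearMap.ext fun A => ContinuousLinearMap.ext fun B => ?_
  rw [warped_apply, pullback_apply, pullback_apply]
  change modelForm g.val (m t (σ q.2))
    ((modelDeriv (fun q : ℝ × F => m (Real.exp q.1) (σ q.2)) q : ℝ × F →L[ℝ] E) A)
    ((modelDeriv (fun q : ℝ × F => m (Real.exp q.1) (σ q.2)) q : ℝ × F →L[ℝ] E) B) = _ *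
      (_ + modelForm g.val (σ q.2) ((modelDeriv σ q.2 : F →L[ℝ] E) A.2)
        ((modelDeriv σ q.2 : F →L[ℝ] E) B.2))
  rw [hD, hD]
  simp only [map_add, map_smul, add_apply, smul_apply, smul_eq_mul]
  rw [hgen, hPP, modelForm_symm g _ _ (modelGenerator E m (m t (σ q.2))), hgen,
    h.modelForm_act ht, htα]
  ring

/-- The coordinates `(τ, p) ↦ m (e^τ) (σ p)` are regular. -/
theorem bijective_modelDeriv_flowMap (hdef : g.IsDefinite) {U : Set F} {σ : F → M} {l : ℝ}
    (hσ : IsLevelParametrization (E := E) f l U σ) {q : ℝ × F} (hq : q.2 ∈ U) :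
    Function.Bijective (modelDeriv (fun q : ℝ × F => m (Real.exp q.1) (σ q.2)) q :
      ℝ × F →L[ℝ] E) := by
  have hσc : ContMDiffAt 𝓘(ℝ, F) 𝓘(ℝ, E) ∞ σ q.2 :=
    hσ.contMDiffOn.contMDiffAt (hσ.isOpen.mem_nhds hq)
  have hD := h.action.modelDeriv_flowMap hσc
  set t := Real.exp q.1
  have ht : 0 < t := Real.exp_pos _
  have hne : α * f (m t (σ q.2)) ≠ 0 := mul_ne_zero h.degree_ne_zero (h.pos _).ne'
  have hker : ∀ u : F, (modelDeriv f (σ q.2) : E →L[ℝ] ℝ) ((modelDeriv σ q.2 : F →L[ℝ] E) u) = 0 :=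
    fun u => (hσ.range_eq _ hq _).1 ⟨u, rfl⟩
  have hG0 : ∀ (z : M) (a : E), modelForm g.val z a a = 0 → a = 0 := by
    intro z a ha
    by_contra hcon
    rcases hdef with hd | hd
    · exact (hd z a hcon).ne' ha
    · exact (hd z a hcon).ne ha
  constructor
  · rw [injective_iff_map_eq_zero]
    intro A hA
    rw [hD] at hA
    -- Applying `df` isolates the generator component, since `df(P) = α f ≠ 0`. The remaining
    -- component is null for `g`, so it vanishes by definiteness.
    have h1 := congrArg (modelDeriv f (m t (σ q.2)) : E →L[ℝ] ℝ) hA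
    rw [map_add, map_smul, h.modelDeriv_generator, h.modelDeriv_act ht, hker, map_zero, mul_zero,
      add_zero, smul_eq_mul, mul_eq_zero] at h1
    have hA1 : A.1 = 0 := h1.resolve_right hne
    rw [hA1, zero_smul, zero_add] at hA
    have h2 := h.modelForm_act ht (σ q.2) ((modelDeriv σ q.2 : F →L[ℝ] E) A.2)
      ((modelDeriv σ q.2 : F →L[ℝ] E) A.2)
    rw [hA, map_zero, eq_comm, mul_eq_zero] at h2
    have h3 := hG0 _ _ (h2.resolve_left (Real.rpow_pos_of_pos ht α).ne')
    have h4 : A.2 = 0 := by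
      apply hσ.injective _ hq
      exact h3.trans (map_zero (modelDeriv σ q.2 : F →L[ℝ] E)).symm
    exact Prod.ext hA1 h4
  · intro c
    -- The coefficient for which `c - a P` lies in `ker df`, hence comes from a vector tangent to
    -- `M_l` transported by `m t`.
    set a : ℝ := (modelDeriv f (m t (σ q.2)) : E →L[ℝ] ℝ) c / (α * f (m t (σ q.2))) with ha
    obtain ⟨b, hb⟩ := h.action.surjective_modelDeriv ht (σ q.2)
      (c - a • (modelGenerator E m (m t (σ q.2))))
    have h1 := h.modelDeriv_act ht (σ q.2) b
    rw [hb, map_sub, map_smul, h.modelDeriv_generator, smul_eq_mul, ha, div_mul_cancel₀ _ hne,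
      sub_self, eq_comm, mul_eq_zero] at h1
    obtain ⟨u, hu⟩ := (hσ.range_eq _ hq b).2
      (h1.resolve_left (Real.rpow_pos_of_pos ht α).ne')
    refine ⟨(a, u), ?_⟩
    rw [hD]
    have hu' : (modelDeriv σ q.2 : F →L[ℝ] E) u = b := hu
    simp only [hu', hb]
    abel

end IsHomogeneousPair

end Pairs

/-! ### The conformal metric in flow coordinates and its curvature. -/

section Main

open ContinuousLinearMap Filter Topology

variable {E : Type*} [NormedAddCommGroup E] [NormedSpace ℝ E]
  {F : Type*} [NormedAddCommGroup F] [NormedSpace ℝ F]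
  {M : Type*} [TopologicalSpace M] [ChartedSpace E M]

theorem pullback_smul (c : M → ℝ) (B : BilinField E M) (σ : F → M) (p : F) :
    pullback (fun y => c y • B y) σ p = c (σ p) • pullback B σ p := rfl

variable [IsManifold 𝓘(ℝ, E) ∞ M]

/-- Along an orbit `f` is multiplied by `e^{ατ}`, so flowing back for time `log (f x / l) / α`
reaches the level `l`. -/
theorem IsHomogeneousPair.exists_level_point {m : ℝ → M → M} {g : PseudoRiemannianMetric E M}
    {f : M → ℝ} {α : ℝ} (hgf : IsHomogeneousPair m g f α) {l : ℝ} (hl : 0 < l) (x : M) :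
    ∃ (τ : ℝ) (y : M), m (Real.exp τ) y = x ∧ f y = l ∧ l * Real.exp (α * τ) = f x := by
  have hexp : l * Real.exp (α * (Real.log (f x / l) / α)) = f x := by
    rw [mul_div_cancel₀ _ hgf.degree_ne_zero, Real.exp_log (div_pos (hgf.pos x) hl)]
    field_simp
  generalize Real.log (f x / l) / α = τ at hexp
  have hyx : m (Real.exp τ) (m (Real.exp τ)⁻¹ x) = x := hgf.action.inv_act (Real.exp_pos _) x
  refine ⟨τ, m (Real.exp τ)⁻¹ x, hyx, ?_, hexp⟩
  have h1 := hgf.homog_fun (Real.exp τ) (Real.exp_pos _) (m (Real.exp τ)⁻¹ x)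
  rw [hyx, ← hexp, ← Real.exp_mul, mul_comm τ α, mul_comm l] at h1
  exact mul_left_cancel₀ (Real.exp_ne_zero (α * τ)) h1.symm

theorem conformal_factor_regular {C α C₁ C₂ ε : ℝ} (hε : ε = 1 ∨ ε = -1)
    (hadm : IsAdmissible (C / α) C₁) {v : ℝ → ℝ}
    (hv : ∀ r ∈ wDomain (C / α) C₁ C₂, v r = 1 / r * w ε (C / α) C₁ C₂ r) {r : ℝ}
    (hr : r ∈ wDomain (C / α) C₁ C₂) : 0 < v r ∧ ContDiffAt ℝ ∞ v r := by
  obtain ⟨φ, hφ⟩ := exists_half_logDeriv_w (s := C / α) (C₂ := C₂) hε hadm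
  have hr0 : 0 < r := hr.1
  have h1 := hφ (Real.log r) (by rwa [Real.exp_log hr0])
  rw [Real.exp_log hr0] at h1
  refine ⟨?_, ?_⟩
  · rw [hv r hr]
    exact mul_pos (by positivity) h1.2.2.2.1
  · refine ContDiffAt.congr_of_eventuallyEq (f := fun r => 1 / r * w ε (C / α) C₁ C₂ r)
      ((contDiffAt_const.div contDiffAt_id hr0.ne').mul h1.2.2.2.2) ?_
    filter_upwards [(isOpen_wDomain _ _ _).mem_nhds hr] with r' hr' using hv r' hr'

/-- Here `log f = α τ + log l` and `v(f) e^{ατ} = w(f) / l`. This affine change of variable replaces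
`φ` by `ψ = α φ`, turning the equations for `s = C / α` into those with `κ = α l` and `D = α C₁ /
l`. -/
theorem exists_warping_function {C α C₁ C₂ ε l : ℝ} (hα : α ≠ 0) (hl : 0 < l)
    (hε : ε = 1 ∨ ε = -1) (hadm : IsAdmissible (C / α) C₁) {v : ℝ → ℝ}
    (hv : ∀ r ∈ wDomain (C / α) C₁ C₂, v r = 1 / r * w ε (C / α) C₁ C₂ r) :
    ∃ W ψ : ℝ → ℝ, ∀ τ, l * Real.exp (α * τ) ∈ wDomain (C / α) C₁ C₂ →
      HasDerivAt W (2 * ψ τ * W τ) τ ∧ HasDerivAt ψ (-(α * l * C * W τ)) τ ∧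
      ψ τ ^ 2 = α * l * (α * C₁ / l - C * W τ) ∧ 0 < W τ ∧ ContDiffAt ℝ ∞ W τ ∧
      v (l * Real.exp (α * τ)) * Real.exp (α * τ) = W τ := by
  obtain ⟨φ, hφ⟩ := exists_half_logDeriv_w (s := C / α) (C₂ := C₂) hε hadm
  have hexpl : ∀ τ, l * Real.exp (α * τ) = Real.exp (α * τ + Real.log l) := by
    intro τ; rw [Real.exp_add, Real.exp_log hl, mul_comm]
  have hlin : ∀ τ, HasDerivAt (fun τ => α * τ + Real.log l) α τ := by
    intro τ
    simpa using ((hasDerivAt_id τ).const_mul α).add_const (Real.log l)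
  refine ⟨fun τ => w ε (C / α) C₁ C₂ (Real.exp (α * τ + Real.log l)) / l,
    fun τ => α * φ (α * τ + Real.log l), fun τ hτ => ?_⟩
  have hvτ := hv _ hτ
  rw [hexpl] at hτ
  obtain ⟨h1, h2, h3, h4, h5⟩ := hφ _ hτ
  refine ⟨?_, ?_, ?_, div_pos h4 hl, ?_, ?_⟩ <;> beta_reduce
  · refine ((h1.comp τ (hlin τ)).div_const l).congr_deriv ?_
    ring
  · refine ((h2.comp τ (hlin τ)).const_mul α).congr_deriv ?_
    field_simp
  · rw [mul_pow, h3]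
    field_simp
  · refine ContDiffAt.div_const (ContDiffAt.comp (g := w ε (C / α) C₁ C₂)
      (f := fun τ => Real.exp (α * τ + Real.log l)) τ h5 ?_) l
    fun_prop
  · rw [hvτ, ← hexpl τ]
    field_simp

theorem pullback_chart_smul_bijective (g : PseudoRiemannianMetric E M) {c : M → ℝ} {x : M} {e : E}
    (he : e ∈ (extChartAt 𝓘(ℝ, E) x).target) (hc : c ((extChartAt 𝓘(ℝ, E) x).symm e) ≠ 0) :
    Function.Bijective (pullback (fun y => c y • g.val y) (extChartAt 𝓘(ℝ, E) x).symm e) := by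
  have h1 : Function.Bijective (pullback g.val (extChartAt 𝓘(ℝ, E) x).symm e) :=
    bilinearComp_bijective (B := modelForm g.val ((extChartAt 𝓘(ℝ, E) x).symm e))
      (g.nondegenerate _) (isInvertible_mfderiv_chart_symm he)
  have h2 : Function.Bijective fun L : E →L[ℝ] ℝ => c ((extChartAt 𝓘(ℝ, E) x).symm e) • L :=
    MulAction.bijective₀ hc
  exact h2.comp h1

theorem pullback_chart_smul_contDiffAt (g : PseudoRiemannianMetric E M) {f : M → ℝ} {v : ℝ → ℝ}
    (hf : ContMDiff 𝓘(ℝ, E) 𝓘(ℝ, ℝ) ∞ f) {x : M} {e : E}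
    (he : e ∈ (extChartAt 𝓘(ℝ, E) x).target)
    (hv : ContDiffAt ℝ ∞ v (f ((extChartAt 𝓘(ℝ, E) x).symm e))) :
    ContDiffAt ℝ ∞ (pullback (fun y => v (f y) • g.val y) (extChartAt 𝓘(ℝ, E) x).symm) e := by
  have h1 : ContDiffAt ℝ ∞ (f ∘ (extChartAt 𝓘(ℝ, E) x).symm) e := by
    rw [← contMDiffAt_iff_contDiffAt]
    exact hf.contMDiffAt.comp e (contMDiffAt_chart_symm he)
  have h2 : ContDiffAt ℝ ∞ (fun e => v (f ((extChartAt 𝓘(ℝ, E) x).symm e))) e :=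
    ContDiffAt.comp (g := v) (f := f ∘ (extChartAt 𝓘(ℝ, E) x).symm) e hv h1
  have h3 := contDiffAt_pullback_chart g x he
  have h4 : pullback (fun y => v (f y) • g.val y) (extChartAt 𝓘(ℝ, E) x).symm =
      fun e => v (f ((extChartAt 𝓘(ℝ, E) x).symm e)) •
        pullback g.val (extChartAt 𝓘(ℝ, E) x).symm e :=
    funext fun e => pullback_smul (fun y => v (f y)) g.val _ e
  rw [h4]
  exact h2.smul h3

/-- A conformal factor `v ∘ f` makes the metric of a homogeneous pair a metric
`W(τ) (α l dτ² + g_l)` in the flow coordinates. -/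
theorem pullback_conformal_flowMap {m : ℝ → M → M} {g : PseudoRiemannianMetric E M} {f : M → ℝ}
    {α : ℝ} (hgf : IsHomogeneousPair m g f α) {v W : ℝ → ℝ} {U : Set F} {σ : F → M} {l : ℝ}
    (hσ : IsLevelParametrization (E := E) f l U σ) {q : ℝ × F} (hq : q.2 ∈ U)
    (hW : v (l * Real.exp (α * q.1)) * Real.exp (α * q.1) = W q.1) :
    pullback (fun y => v (f y) • g.val y) (fun q : ℝ × F => m (Real.exp q.1) (σ q.2)) q =
      warped (α * l) W (pullback g.val σ) q := by
  rw [pullback_smul (fun y => v (f y)), hgf.pullback_flowMap hσ hq, hgf.f_flowMap hσ hq, warped,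
    warped, smul_smul, hW]

theorem isInvertible_fderiv_chart_flowMap {m : ℝ → M → M} {g : PseudoRiemannianMetric E M}
    {f : M → ℝ} [CompleteSpace E] [CompleteSpace F]
    {α : ℝ} (hgf : IsHomogeneousPair m g f α) (hdef : g.IsDefinite) {U : Set F} {σ : F → M} {l : ℝ}
    (hσ : IsLevelParametrization (E := E) f l U σ) {q : ℝ × F} (hq : q.2 ∈ U) {x : M}
    (hx : m (Real.exp q.1) (σ q.2) ∈ (extChartAt 𝓘(ℝ, E) x).source) :
    (fderiv ℝ (extChartAt 𝓘(ℝ, E) x ∘ fun q : ℝ × F => m (Real.exp q.1) (σ q.2)) q).IsInvertible := by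
  apply isInvertible_of_bijective
  have hb := hgf.bijective_modelDeriv_flowMap hdef hσ hq
  have hD := isInvertible_mfderiv_chart_symm ((extChartAt 𝓘(ℝ, E) x).map_source hx)
  have hc := fun u => mfderiv_chart_symm_comp ((hgf.action.contMDiffAt_flowMap
    (hσ.contMDiffOn.contMDiffAt (hσ.isOpen.mem_nhds hq))).mdifferentiableAt (by simp)) hx u
  constructor
  · intro u w huw
    apply hb.1
    refine (hc u).trans (Eq.trans ?_ (hc w).symm)
    rw [huw]
  · intro a
    obtain ⟨u, hu⟩ := hb.2 ((mfderiv 𝓘(ℝ, E) 𝓘(ℝ, E) (extChartAt 𝓘(ℝ, E) x).symm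
      (extChartAt 𝓘(ℝ, E) x (m (Real.exp q.1) (σ q.2))) : E →L[ℝ] E) a)
    exact ⟨u, hD.injective ((hc u).symm.trans hu)⟩

/-- The plane in the level set and the factor `c ≥ 0` do not depend on the direction of the
comparison, so both inequalities and the equality can be read off from this one identity. -/
theorem sectionalCurvature_conformal [CompleteSpace E] (hF : Nonempty (E ≃L[ℝ] (ℝ × F)))
    {m : ℝ → M → M} {g : PseudoRiemannianMetric E M} {f : M → ℝ} {α : ℝ}
    (hgf : IsHomogeneousPair m g f α) (hdef : g.IsDefinite)
    {C C₁ C₂ ε : ℝ} (hε : ε = 1 ∨ ε = -1) (hadm : IsAdmissible (C / α) C₁) {v : ℝ → ℝ}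
    (hv : ∀ r ∈ wDomain (C / α) C₁ C₂, v r = 1 / r * w ε (C / α) C₁ C₂ r)
    {l : ℝ} (hl : 0 < l) {x : M} (hx : f x ∈ wDomain (C / α) C₁ C₂)
    {a b : E} (hab : LinearIndependent ℝ ![a, b]) :
    sectionalCurvature (fun y => v (f y) • g.val y) x a b = C ∨
      ∃ (U : Set F) (σ : F → M) (p u u' : F), IsLevelParametrization (E := E) f l U σ ∧ p ∈ U ∧
        LinearIndependent ℝ ![u, u'] ∧ ∃ c, 0 ≤ c ∧
          sectionalCurvature (fun y => v (f y) • g.val y) x a b - C =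
            c * (coordSectionalCurvature (pullback g.val σ) p u u' - α * C₁ / l) := by
  obtain ⟨e⟩ := hF
  have hFc : CompleteSpace F := completeSpace_of_equiv_real_prod e
  have hα := hgf.degree_ne_zero
  obtain ⟨W, ψ, hWψ⟩ := exists_warping_function hα hl hε hadm hv
  set S := wDomain (C / α) C₁ C₂
  have hSo : IsOpen S := isOpen_wDomain _ _ _
  have hvr : ∀ r ∈ S, 0 < v r ∧ ContDiffAt ℝ ∞ v r := fun r hr =>
    conformal_factor_regular hε hadm hv hr
  set B := fun y => v (f y) • g.val y
  obtain ⟨τ₀, y, hyx, hfy, hexp⟩ := hgf.exists_level_point hl x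
  have hne : α * f y ≠ 0 := mul_ne_zero hα (hgf.pos y).ne'
  obtain ⟨U, σ, p₀, hp₀, hσy, hσ⟩ := exists_isLevelParametrization e hgf.contMDiff (y := y)
    (b := modelGenerator E m y)
    (fun h0 => hne ((hgf.modelDeriv_generator y).symm.trans h0))
  rw [hfy] at hσ
  set Φ := fun q : ℝ × F => m (Real.exp q.1) (σ q.2) with hΦ
  set q₀ : ℝ × F := (τ₀, p₀) with hq₀
  have hΦ₀ : Φ q₀ = x := by simp [hΦ, hq₀, hσy, hyx]
  set h := pullback g.val σ
  set χ := extChartAt 𝓘(ℝ, E) x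
  have hτ₀S : l * Real.exp (α * τ₀) ∈ S := by rwa [hexp]
  -- neighbourhoods
  have hτev : ∀ᶠ τ in 𝓝 τ₀, l * Real.exp (α * τ) ∈ S := by
    have hc : Continuous fun τ => l * Real.exp (α * τ) := by fun_prop
    exact hc.continuousAt (hSo.mem_nhds (by rw [hexp]; exact hx))
  have hUev : ∀ᶠ p in 𝓝 p₀, p ∈ U := hσ.isOpen.mem_nhds hp₀
  have hσs : ∀ p ∈ U, ContMDiffAt 𝓘(ℝ, F) 𝓘(ℝ, E) ∞ σ p := fun p hp =>
    hσ.contMDiffOn.contMDiffAt (hσ.isOpen.mem_nhds hp)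
  have hΦs : ∀ q : ℝ × F, q.2 ∈ U → ContMDiffAt 𝓘(ℝ, ℝ × F) 𝓘(ℝ, E) ∞ Φ q := fun q hq =>
    hgf.action.contMDiffAt_flowMap (hσs _ hq)
  have hqev : ∀ᶠ q in 𝓝 q₀, l * Real.exp (α * q.1) ∈ S ∧ q.2 ∈ U ∧ Φ q ∈ χ.source := by
    have h1 : ∀ᶠ q in 𝓝 q₀, l * Real.exp (α * q.1) ∈ S :=
      (continuous_fst.tendsto q₀).eventually hτev
    have h2 : ∀ᶠ q in 𝓝 q₀, q.2 ∈ U := (continuous_snd.tendsto q₀).eventually hUev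
    have h3 : ∀ᶠ q in 𝓝 q₀, Φ q ∈ χ.source := by
      refine (hΦs q₀ hp₀).continuousAt.eventually_mem ?_
      rw [hΦ₀]
      exact (isOpen_extChartAt_source x).mem_nhds (mem_extChartAt_source x)
    filter_upwards [h1, h2, h3] with q a1 a2 a3 using ⟨a1, a2, a3⟩
  have heev : ∀ᶠ e in 𝓝 (χ x), e ∈ χ.target ∧ f (χ.symm e) ∈ S := by
    have h1 : ∀ᶠ e in 𝓝 (χ x), e ∈ χ.target :=
      (isOpen_extChartAt_target x).mem_nhds (mem_extChartAt_target x)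
    have h2 : ContinuousAt (f ∘ χ.symm) (χ x) :=
      hgf.contMDiff.continuous.continuousAt.comp
        (contMDiffAt_chart_symm (mem_extChartAt_target x)).continuousAt
    have h3 : ∀ᶠ e in 𝓝 (χ x), f (χ.symm e) ∈ S := by
      refine h2.eventually_mem (hSo.mem_nhds ?_)
      rw [Function.comp_apply, extChartAt_to_inv]
      exact hx
    exact h1.and h3
  have hΨ₀ : (χ ∘ Φ) q₀ = χ x := congrArg χ hΦ₀
  -- the two coordinate expressions of the conformal metric
  have hwarp : ∀ q : ℝ × F, l * Real.exp (α * q.1) ∈ S → q.2 ∈ U →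
      pullback B Φ q = warped (α * l) W h q := fun q hq1 hq2 =>
    pullback_conformal_flowMap hgf hσ hq2 (hWψ _ hq1).2.2.2.2.2
  have heq : ∀ q : ℝ × F, l * Real.exp (α * q.1) ∈ S → q.2 ∈ U → Φ q ∈ χ.source →
      warped (α * l) W h q = (pullback B χ.symm ((χ ∘ Φ) q)).bilinearComp
        (fderiv ℝ (χ ∘ Φ) q) (fderiv ℝ (χ ∘ Φ) q) := fun q hq1 hq2 hq3 => by
    rw [← hwarp q hq1 hq2]
    exact pullback_eq_bilinearComp B ((hΦs q hq2).mdifferentiableAt (by simp)) hq3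
  have hΨi : ∀ q : ℝ × F, q.2 ∈ U → Φ q ∈ χ.source →
      (fderiv ℝ (χ ∘ Φ) q).IsInvertible := fun q hq2 hq3 =>
    isInvertible_fderiv_chart_flowMap hgf hdef hσ hq2 hq3
  have hGb : ∀ e ∈ χ.target, f (χ.symm e) ∈ S → Function.Bijective (pullback B χ.symm e) :=
    fun e he hfe => pullback_chart_smul_bijective g he (hvr _ hfe).1.ne'
  have hGs : ∀ e ∈ χ.target, f (χ.symm e) ∈ S → ContDiffAt ℝ ∞ (pullback B χ.symm) e :=
    fun e he hfe => pullback_chart_smul_contDiffAt g hgf.contMDiff he (hvr _ hfe).2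
  have hGsymm : ∀ e u u', pullback B χ.symm e u u' = pullback B χ.symm e u' u := by
    intro e u u'
    exact congrArg (v (f (χ.symm e)) * ·) (modelForm_symm g _ _ _)
  have hhsymm : ∀ p u u', h p u u' = h p u' u := fun p u u' => modelForm_symm g _ _ _
  have hhs : ∀ p ∈ U, ContDiffAt ℝ ∞ h p := by
    intro p hp
    refine contDiffAt_pullback g ?_
    filter_upwards [hσ.isOpen.mem_nhds hp] with p' hp' using hσs p' hp'
  -- Nondegeneracy of the warped form comes from `g`: it is the nonzero multiple `v(f) g` in the
  -- chart, pulled back by an isomorphism. Its block structure then gives nondegeneracy of `h`.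
  have hwb : ∀ᶠ q in 𝓝 q₀, Function.Bijective (warped (α * l) W h q) := by
    have hΨc : Tendsto (χ ∘ Φ) (𝓝 q₀) (𝓝 (χ x)) := by
      rw [← hΨ₀]
      exact (contDiffAt_chart_comp (hΦs q₀ hp₀) hqev.self_of_nhds.2.2).continuousAt
    filter_upwards [hqev, hΨc.eventually heev] with q hq he
    rw [heq q hq.1 hq.2.1 hq.2.2]
    exact bilinearComp_bijective (hGb _ he.1 he.2) (hΨi q hq.2.1 hq.2.2)
  have hhb : ∀ᶠ p in 𝓝 p₀, Function.Bijective (h p) := by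
    have hc : Continuous fun p : F => (τ₀, p) := by fun_prop
    filter_upwards [(hc.tendsto p₀).eventually hwb] with p hp
    exact warped_bijective_right hp
  obtain ⟨A, hA⟩ := (hΨi q₀ hp₀ hqev.self_of_nhds.2.2).surjective a
  obtain ⟨A', hA'⟩ := (hΨi q₀ hp₀ hqev.self_of_nhds.2.2).surjective b
  have hAA' : LinearIndependent ℝ ![A, A'] := by
    refine LinearIndependent.of_comp (fderiv ℝ (χ ∘ Φ) q₀ : ℝ × F →ₗ[ℝ] E) ?_
    convert hab using 1
    ext i
    fin_cases i
    · exact hA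
    · exact hA'
  -- Passage from the preferred chart at `x` to flow coordinates, by naturality under `χ ∘ Φ`.
  have hK : sectionalCurvature B x a b = coordSectionalCurvature (warped (α * l) W h) q₀ A A' := by
    rw [← coordSectionalCurvature_pullback (ψ := χ ∘ Φ) (G := pullback B χ.symm) (p := q₀)
      (G' := warped (α * l) W h) ?_ ?_ ?_ ?_ ?_ ?_ ?_ ?_ A A', hA, hA', hΨ₀]
    · rfl
    · filter_upwards [hqev] with q hq using contDiffAt_chart_comp (hΦs q hq.2.1) hq.2.2
    · filter_upwards [hqev] with q hq using hΨi q hq.2.1 hq.2.2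
    · rw [hΨ₀]
      filter_upwards [heev] with e he using hGs e he.1 he.2
    · rw [hΨ₀]
      filter_upwards [heev] with e he using isInvertible_of_bijective (hGb e he.1 he.2)
    · filter_upwards [hqev] with q hq using contDiffAt_warped (hWψ _ hq.1).2.2.2.2.1 (hhs _ hq.2.1)
    · filter_upwards [hwb] with q hq using isInvertible_of_bijective hq
    · exact Eventually.of_forall fun e => hGsymm e
    · filter_upwards [hqev] with q hq using heq q hq.1 hq.2.1 hq.2.2
  have hdefw : FormIsDefinite (warped (α * l) W h q₀) := by
    have hb := hgf.bijective_modelDeriv_flowMap hdef hσ (q := q₀) hp₀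
    rw [← hwarp q₀ hτ₀S hp₀]
    have hne : ∀ a : ℝ × F, a ≠ 0 → (modelDeriv Φ q₀ : ℝ × F →L[ℝ] E) a ≠ 0 := fun a ha h0 =>
      ha (hb.1 (h0.trans (map_zero (modelDeriv Φ q₀ : ℝ × F →L[ℝ] E)).symm))
    have hvx : 0 < v (f (Φ q₀)) := by rw [hΦ₀]; exact (hvr _ hx).1
    rcases hdef with hd | hd
    · left
      intro a ha
      exact mul_pos hvx (hd (Φ q₀) _ (hne a ha))
    · right
      intro a ha
      exact mul_neg_of_pos_of_neg hvx (hd (Φ q₀) _ (hne a ha))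
  rcases coordSectionalCurvature_warped (κ := α * l) (C := C) (D := α * C₁ / l) (ψ := ψ) (q := q₀)
    (mul_ne_zero hα hl.ne') (hτev.mono fun τ hτ => (hWψ τ hτ).1) (hWψ _ hτ₀S).2.1
    (hWψ _ hτ₀S).2.2.1 (hWψ _ hτ₀S).2.2.2.1
    (hτev.mono fun τ hτ => (hWψ τ hτ).2.2.2.2.1) (hUev.mono hhs) (hhb.mono fun p hp => isInvertible_of_bijective hp)
    (hwb.mono fun p hp => isInvertible_of_bijective hp)
    (Eventually.of_forall hhsymm) hdefw hAA' with hc | ⟨hli, c, hc0, hc⟩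
  · left
    rw [hK, hc]
  · right
    exact ⟨U, σ, p₀, A.2, A'.2, hσ, hp₀, hli, c, hc0, by rw [hK, hc]⟩

end Main

end HomogPair

end

theorem corollary3p12
    {E : Type*} [NormedAddCommGroup E] [NormedSpace ℝ E] [CompleteSpace E]
    {F : Type*} [NormedAddCommGroup F] [NormedSpace ℝ F]
    (hF : Nonempty (E ≃L[ℝ] (ℝ × F)))
    {M : Type*} [TopologicalSpace M] [ChartedSpace E M] [IsManifold 𝓘(ℝ, E) ∞ M]
    (m : ℝ → M → M) (g : HomogPair.PseudoRiemannianMetric E M) (f : M → ℝ) (α : ℝ)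
    (hgf : HomogPair.IsHomogeneousPair m g f α)
    (hdef : g.IsDefinite)
    (C C₁ C₂ ε : ℝ) (hε : ε = 1 ∨ ε = -1)
    (hadm : HomogPair.IsAdmissible (C / α) C₁)
    (v : ℝ → ℝ)
    (hv : ∀ r ∈ HomogPair.wDomain (C / α) C₁ C₂,
      v r = 1 / r * HomogPair.w ε (C / α) C₁ C₂ r)
    (l : ℝ) (hl : 0 < l) :
    (HomogPair.LevelSectionalCurvature F g.val f l (fun K => α * C₁ ≤ l * K) →
      ∀ x : M, f x ∈ HomogPair.wDomain (C / α) C₁ C₂ →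
        ∀ a b : TangentSpace 𝓘(ℝ, E) x, LinearIndependent ℝ ![a, b] →
          C ≤ HomogPair.sectionalCurvature (fun y => v (f y) • g.val y) x a b) ∧
    (HomogPair.LevelSectionalCurvature F g.val f l (fun K => l * K ≤ α * C₁) →
      ∀ x : M, f x ∈ HomogPair.wDomain (C / α) C₁ C₂ →
        ∀ a b : TangentSpace 𝓘(ℝ, E) x, LinearIndependent ℝ ![a, b] →
          HomogPair.sectionalCurvature (fun y => v (f y) • g.val y) x a b ≤ C) ∧
    (HomogPair.LevelSectionalCurvature F g.val f l (fun K => l * K = α * C₁) →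
      ∀ x : M, f x ∈ HomogPair.wDomain (C / α) C₁ C₂ →
        ∀ a b : TangentSpace 𝓘(ℝ, E) x, LinearIndependent ℝ ![a, b] →
          HomogPair.sectionalCurvature (fun y => v (f y) • g.val y) x a b = C) := by
  have key := fun (x : M) (hx : f x ∈ HomogPair.wDomain (C / α) C₁ C₂)
    (a b : TangentSpace 𝓘(ℝ, E) x) (hab : LinearIndependent ℝ ![a, b]) =>
    HomogPair.sectionalCurvature_conformal hF hgf hdef hε hadm hv hl hx hab
  refine ⟨fun hQ x hx a b hab => ?_, fun hQ x hx a b hab => ?_, fun hQ x hx a b hab => ?_⟩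
  · rcases key x hx a b hab with hK | ⟨U, σ, p, u, u', hσ, hp, hli, c, hc, hK⟩
    · exact hK.ge
    · have h1 := hQ U σ hσ p hp u u' hli
      rw [← sub_nonneg, hK]
      exact mul_nonneg hc (sub_nonneg.2 ((div_le_iff₀' hl).2 h1))
  · rcases key x hx a b hab with hK | ⟨U, σ, p, u, u', hσ, hp, hli, c, hc, hK⟩
    · exact hK.le
    · have h1 := hQ U σ hσ p hp u u' hli
      rw [← sub_nonpos, hK]
      exact mul_nonpos_of_nonneg_of_nonpos hc (sub_nonpos.2 ((le_div_iff₀' hl).2 h1))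
  · rcases key x hx a b hab with hK | ⟨U, σ, p, u, u', hσ, hp, hli, c, hc, hK⟩
    · exact hK
    · have h1 := hQ U σ hσ p hp u u' hli
      rw [← sub_eq_zero, hK, sub_eq_zero.2 ((eq_div_iff hl.ne').2 (by rw [mul_comm]; exact h1)),
        mul_zero]
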